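/- Let $\lambda>0$, $T>0$, $b\in(0,1]$. A real process $(X_t)_{0\le t\le T}$ is called an exponential process $\mathrm{Exp}(\lambda,b,T)$ if $X_0=0$ almost surely and if, for all $m\in\mathbb N$, $0=t_0<t_1<\dots<t_m\le T$ and $s_1,\dots,s_m\in\mathbb R$, with $S_i=\sum_{j=i}^m s_j$, $$\mathrm E\Big(e^{s_1X_{t_1}+\dots+s_mX_{t_m}}\Big)=1+b e^{-\lambda T}\sum_{\emptyset\ne C\subset\{1,\dots,m\}}\ \sum_{(k_i)_{i\in C},\,k_i\ge1}\Big(\prod_{i\in C}S_i^{k_i}\Big)\int_{Q}\prod_{i\in C_2}\frac{(x_i-x_i')^{k_i-2}}{(k_i-2)!}\;e^{-\lambda(x_{\max C}-y)}\,dx'\,dx ,$$ where the left side is finite and the series converges absolutely. Here $C_2=\{i\in C:k_i\ge2\}$, the integration variables are $x_i$ $(i\in C)$ and $x_i'$ $(i\in C_2)$, the domain $Q$ is given by $t_{i-1}<x_i<t_i$ $(i\in C)$ and $t_{i-1}<x_i'<x_i$ $(i\in C_2)$, and with $i_0=\min C$ we put $y=x_{i_0}'$ if $i_0\in C_2$ and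 $y=x_{i_0}$ otherwise. Let $X$ be an $\mathrm{Exp}(\lambda,b,T)$ process and $\nabla X_t=X_t-X_{t-d}$ for $0<d\le t\le T$. Write $f\sim g$ if $f/g\to1$. Then every $\nabla X_t$ has finite moments of all orders, and the following hold. (i) Let $0<t<s\le T$. If $0<d\le t$ and $d<s-t$, then $$\mathrm E(\nabla X_t\nabla X_s)=\frac{b e^{-\lambda T}}{\lambda^2}\,e^{-\lambda(s-t)}\big(e^{\lambda d}-2+e^{-\lambda d}\big).$$ As $d\to0^+$, $$\mathrm E(\nabla X_t\nabla X_s)\sim d^2\, b e^{-\lambda T}e^{-\lambda(s-t)},\qquad \mathrm{cov}(\nabla X_t,\nabla X_s)\sim d^2\, b e^{-\lambda T}\big(e^{-\lambda(s-t)}-b e^{-\lambda T}\big),$$ $$\mathrm{corr}(\nabla X_t,\nabla X_s)\sim\frac{e^{-\lambda(s-t)}-b e^{-\lambda T}}{1-b e^{-\lambda T}} .$$ (ii) Fix $d>0$. For $d\le t<s\le T$, as $s-t\to0$, $$\mathrm{corr}(\nabla X_t,\nabla X_s)\sim 1-c'(s-t),\qquad c'=\frac{2b e^{-\lambda T}}{\lambda^2\,\mathrm{var}(\nabla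 X_t)},$$ in the sense that the ratio of the two sides tends to $1$; moreover the deviation from $1$ is quadratic, $$1-\mathrm{corr}(\nabla X_t,\nabla X_s)\sim\frac{b e^{-\lambda T}(1-e^{-\lambda d})}{\mathrm{var}(\nabla X_t)}\,(s-t)^2 .$$ (iii) For all $m\ge1$, $0<t_1<\dots<t_m\le T$ and integers $k_1,\dots,k_m\ge1$, with $c'=b e^{-\lambda T}$, as $d\to0^+$, $$\mathrm E\Big(\prod_{i=1}^m(\nabla X_{t_i})^{k_i}\Big)\sim d^{\,k_1+\dots+k_m}\,c'\,e^{-\lambda(t_m-t_1)},\qquad \lim_{d\to0^+}\frac{\mathrm E\big(\prod_{i=1}^m(\nabla X_{t_i})^{k_i}\big)}{\prod_{i=1}^m\mathrm E\big((\nabla X_{t_i})^{k_i}\big)}=(1/c')^{m-1}e^{-\lambda(t_m-t_1)} .$$ -/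

import Mathlib

open MeasureTheory ProbabilityTheory Filter Topology Asymptotics

noncomputable section

namespace ExpProcess

/-- The set `C` of indices that occur in the multi-index `k`. -/
def supp {m : ℕ} (k : Fin m → ℕ) : Finset (Fin m) := Finset.univ.filter fun i => 1 ≤ k i

/-- The set `C₂ ⊆ C` of indices that occur at least twice in the multi-index `k`. -/
def supp₂ {m : ℕ} (k : Fin m → ℕ) : Finset (Fin m) := Finset.univ.filter fun i => 2 ≤ k i

theorem supp₂_subset {m : ℕ} (k : Fin m → ℕ) {i : Fin m} (hi : i ∈ supp₂ k) : i ∈ supp k := by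
  simp only [supp, supp₂, Finset.mem_filter, Finset.mem_univ, true_and] at hi ⊢
  omega

theorem supp_nonempty {m : ℕ} {k : Fin m → ℕ} (hk : k ≠ 0) : (supp k).Nonempty := by
  obtain ⟨i, hi⟩ := Function.ne_iff.mp hk
  exact ⟨i, by simpa [supp, Nat.one_le_iff_ne_zero] using hi⟩

/-- The integration variables: `p.1 i = x_i` for `i ∈ C`, and `p.2 i = x_i'` for `i ∈ C₂`. -/
abbrev Pts {m : ℕ} (k : Fin m → ℕ) : Type := (supp k → ℝ) × (supp₂ k → ℝ)

/-- The domain of integration, for `0 = t 0 < t 1 < ⋯ < t m`.  The `i`-th time interval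
(`i = 0, …, m - 1`) is `(t i.castSucc, t i.succ)`; it contains `x_i` if `i ∈ C`, and
`x_i' < x_i` if `i ∈ C₂`. -/
def region {m : ℕ} (t : Fin (m + 1) → ℝ) (k : Fin m → ℕ) : Set (Pts k) :=
  {p | (∀ i : supp k, t i.1.castSucc < p.1 i ∧ p.1 i < t i.1.succ) ∧
       ∀ i : supp₂ k, t i.1.castSucc < p.2 i ∧ p.2 i < p.1 ⟨i.1, supp₂_subset k i.2⟩}

/-- The leftmost point of the `i`-th time interval: `x_i'` if `i ∈ C₂`, and `x_i` otherwise. -/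
def leftPt {m : ℕ} {k : Fin m → ℕ} (p : Pts k) (i : supp k) : ℝ :=
  if h : i.1 ∈ supp₂ k then p.2 ⟨i.1, h⟩ else p.1 i

/-- The difference between the rightmost point (the `x_i` of the last index `i ∈ C`) and the
leftmost point (the `x_i'` or `x_i` of the first index `i ∈ C`). -/
def spread {m : ℕ} {k : Fin m → ℕ} (hk : k ≠ 0) (p : Pts k) : ℝ :=
  p.1 ⟨(supp k).max' (supp_nonempty hk), Finset.max'_mem _ _⟩
    - leftPt p ⟨(supp k).min' (supp_nonempty hk), Finset.min'_mem _ _⟩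

/-- The coefficient of `∏ S_i ^ k_i` in the moment generating function of the increments of the
process over the time intervals `(t i.castSucc, t i.succ)`. -/
def mgfCoeff {m : ℕ} (lam b T : ℝ) (t : Fin (m + 1) → ℝ) (k : Fin m → ℕ) : ℝ :=
  if hk : k = 0 then 1
  else b * Real.exp (-lam * T) *
    ∫ p in region t k,
      (∏ i : supp₂ k,
        (p.1 ⟨i.1, supp₂_subset k i.2⟩ - p.2 i) ^ (k i.1 - 2) / (Nat.factorial (k i.1 - 2) : ℝ))
      * Real.exp (-lam * spread hk p)

end ExpProcess

/-- `X` (on the time interval `[0, T]`) is an exponential process `Exp(lam, b, T)`: it starts at `0`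
and, for all `0 = t 0 < t 1 < ⋯ < t m ≤ T` and all real `s_0, …, s_{m-1}`, the random vector
`(X (t 1), …, X (t m))` has the everywhere convergent moment generating function
`E exp (∑ j, s_j X (t (j+1))) = ∑ k, mgfCoeff k * ∏ i, S_i ^ k_i`, where
`S_i = ∑ j ≥ i, s_j`.  (The sum over all multi-indices `k ≠ 0` is the double sum over the nonempty
sets `C` of indices and over the families of positive integers `(k_i)`, `i ∈ C`; the multi-index
`k = 0` contributes the summand `1`.)  Only the law of `X` matters here, so no regularity of the
paths is required. -/
structure IsExpProcess {Ω : Type*} [MeasurableSpace Ω] (μ : Measure Ω) (X : ℝ → Ω → ℝ)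
    (lam b T : ℝ) : Prop where
  aemeasurable : ∀ t ∈ Set.Icc 0 T, AEMeasurable (X t) μ
  zero : ∀ᵐ ω ∂μ, X 0 ω = 0
  integrable_exp : ∀ (m : ℕ) (t : Fin (m + 1) → ℝ), t 0 = 0 → StrictMono t → t (Fin.last m) ≤ T →
    ∀ s : Fin m → ℝ, Integrable (fun ω => Real.exp (∑ j, s j * X (t j.succ) ω)) μ
  hasSum_mgf : ∀ (m : ℕ) (t : Fin (m + 1) → ℝ), t 0 = 0 → StrictMono t → t (Fin.last m) ≤ T →
    ∀ s : Fin m → ℝ,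
      HasSum (fun k : Fin m → ℕ =>
          ExpProcess.mgfCoeff lam b T t k * ∏ i, (∑ j ∈ Finset.Ici i, s j) ^ k i)
        (∫ ω, Real.exp (∑ j, s j * X (t j.succ) ω) ∂μ)

/-- The increment `∇X_t = X_t - X_{t-d}`. -/
def increment {Ω : Type*} (X : ℝ → Ω → ℝ) (d t : ℝ) (ω : Ω) : ℝ := X t ω - X (t - d) ω

/-- The correlation coefficient of two real random variables. -/
def corr {Ω : Type*} [MeasurableSpace Ω] (Y Z : Ω → ℝ) (μ : Measure Ω) : ℝ :=
  cov[Y, Z; μ] / (Real.sqrt (Var[Y; μ]) * Real.sqrt (Var[Z; μ]))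

end

/-! The moment generating function determines the mixed moments of the increments. With `D i` the
increment over the `i`-th interval of a grid starting at `0`, summation by parts turns `∑ j, s j * X
(t j.succ)` into `∑ i, S i * D i`, so the hypothesis is a power series in the free variables `S`.
Comparing it with the exponential series integrated termwise gives the moments as factorials times
`mgfCoeff` (`integral_prod_increments_pow`). The intervals interact only through `exp (-lam *
spread)`, which splits into a function of one rightmost point and a function of one leftmost point.
By Fubini the coefficient is a product of one-interval integrals (`mgfCoeff_eq_prod`). Replacing the
exponential weights by their endpoint values leaves `(r - l) ^ k / k!`, and the factorials cancel.
For increments of length `d` the resulting lower and upper bounds differ only by the factors `exp (∓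
lam * d)`; squeezing gives every limit `d → 0` in (i) and (iii)
(`tendsto_integral_prod_increment_pow_div`). The exact formulas come from multiplicities one and
two, where the block integrals are elementary. They give `E (X u * X v)` (`integral_mul_eq`), and
bilinearity gives the covariance of two increments, disjoint or overlapping. The variance of an
increment does not depend on its position, so in (ii) `1 - corr` is explicit in `h = s - t`: a
combination of second-order Taylor remainders of `exp (± lam * h)`, hence quadratic. The division
needs positive variance, which rests on `sq_mul_exp_neg_lt`. -/

/-! ### Power series in several variables -/

/-- A power series in one real variable that sums to zero everywhere has zero coefficients. -/
theorem eq_zero_of_hasSum_pow {a : ℕ → ℝ} (h : ∀ x : ℝ, HasSum (fun n => a n * x ^ n) 0) (n : ℕ) :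
    a n = 0 := by
  have hp : HasFPowerSeriesAt (fun _ : ℝ => (0 : ℝ)) (FormalMultilinearSeries.ofScalars ℝ a) 0 := by
    rw [hasFPowerSeriesAt_iff]
    refine Eventually.of_forall fun x => ?_
    simpa [mul_comm] using h x
  have := congrArg (fun p => FormalMultilinearSeries.coeff p n) hp.eq_zero
  rw [FormalMultilinearSeries.coeff_ofScalars] at this
  exact this.trans rfl

/-- A power series in several real variables that sums to zero everywhere has zero
coefficients. -/
theorem eq_zero_of_hasSum_prod_pow {m : ℕ} {a : (Fin m → ℕ) → ℝ}
    (h : ∀ S : Fin m → ℝ, HasSum (fun k => a k * ∏ i, S i ^ k i) 0) (k : Fin m → ℕ) :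
    a k = 0 := by
  induction m with
  | zero =>
    have h0 := h (fun _ => 0)
    have := h0.unique (hasSum_fintype _)
    rw [Fintype.sum_unique] at this
    simp only [Finset.univ_eq_empty, Finset.prod_empty, mul_one] at this
    rw [this]
    exact congrArg a (Subsingleton.elim _ _)
  | succ m ih =>
    have key : ∀ (S : Fin m → ℝ) (x : ℝ), HasSum
        (fun p : ℕ × (Fin m → ℕ) => a (Fin.cons p.1 p.2) * x ^ p.1 * ∏ i, S i ^ p.2 i) 0 := by
      intro S x
      have := (Fin.consEquiv (fun _ : Fin (m + 1) => ℕ)).hasSum_iff.mpr (h (Fin.cons x S))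
      refine this.congr_fun ?_
      intro p
      simp [Fin.consEquiv, Fin.prod_univ_succ, mul_assoc]
    have hz : ∀ n : ℕ, ∀ S : Fin m → ℝ,
        HasSum (fun k' : Fin m → ℕ => a (Fin.cons n k') * ∏ i, S i ^ k' i) 0 := by
      intro n S
      have hsum : ∀ n, Summable
          (fun k' : Fin m → ℕ => a (Fin.cons n k') * ∏ i, S i ^ k' i) := by
        intro n
        -- At `x = 1` the factor `x ^ n` disappears, leaving the bare slice.
        have := (key S 1).summable.prod_factor n
        simpa using this
      have h0 := eq_zero_of_hasSum_pow
        (a := fun n => ∑' k' : Fin m → ℕ, a (Fin.cons n k') * ∏ i, S i ^ k' i) (fun x => by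
          refine (key S x).prod_fiberwise fun n => ?_
          have := (hsum n).hasSum.mul_right (x ^ n)
          refine this.congr_fun fun k' => by ring) n
      rw [← h0]
      exact (hsum n).hasSum
    rw [← Fin.cons_self_tail k]
    exact ih (hz (k 0)) (Fin.tail k)

/-- The product of the exponential series in finitely many variables. -/
theorem hasSum_prod_pow_div_factorial {m : ℕ} (x : Fin m → ℝ) :
    HasSum (fun k : Fin m → ℕ => ∏ i, (x i ^ k i / (k i).factorial)) (Real.exp (∑ i, x i)) := by
  -- Summability is proved first for nonnegative entries and later applied to `|x i|`; absolute
  -- convergence then justifies multiplying the series.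
  have aux : ∀ {m : ℕ} (x : Fin m → ℝ), (∀ i, 0 ≤ x i) →
      Summable (fun k : Fin m → ℕ => ∏ i, (x i ^ k i / (k i).factorial)) := by
    intro m
    induction m with
    | zero => intro x _; exact (hasSum_fintype _).summable
    | succ m ih =>
      intro x hx
      rw [← (Fin.consEquiv (fun _ : Fin (m + 1) => ℕ)).summable_iff]
      have h1 := (Real.summable_pow_div_factorial (x 0)).mul_of_nonneg
        (ih (fun i => x i.succ) fun i => hx _)
        (fun n => by have := hx 0; positivity)
        (fun k => Finset.prod_nonneg fun i _ => by have := hx i.succ; positivity)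
      refine h1.congr fun p => ?_
      simp [Fin.consEquiv, Fin.prod_univ_succ, mul_div_mul_comm]
  induction m with
  | zero =>
    simp
  | succ m ih =>
    rw [← (Fin.consEquiv (fun _ : Fin (m + 1) => ℕ)).hasSum_iff, Fin.sum_univ_succ, Real.exp_add]
    have h0 : HasSum (fun n : ℕ => x 0 ^ n / n.factorial) (Real.exp (x 0)) := by
      rw [Real.exp_eq_exp_ℝ]; exact NormedSpace.expSeries_div_hasSum_exp (x 0)
    have hs : Summable (fun p : ℕ × (Fin m → ℕ) =>
        x 0 ^ p.1 / p.1.factorial * ∏ i, (x i.succ ^ p.2 i / (p.2 i).factorial)) := by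
      have := aux (fun i => |x i|) (fun i => abs_nonneg _)
      rw [← (Fin.consEquiv (fun _ : Fin (m + 1) => ℕ)).summable_iff] at this
      refine this.of_norm_bounded fun p => le_of_eq ?_
      simp [Fin.consEquiv, Fin.prod_univ_succ, mul_div_mul_comm]
    refine (h0.mul (ih fun i => x i.succ) hs).congr_fun fun p => ?_
    simp [Fin.consEquiv, Fin.prod_univ_succ, mul_div_mul_comm]

/-! ### Moments from the moment generating function -/

section Moments

variable {Ω : Type*} [MeasurableSpace Ω] {μ : Measure Ω}

/-- At each point the absolute values amount to one choice of signs for `S`, so the function is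
dominated by the finite sum of the exponentials over all sign vectors. This is the majorant for
termwise integration. -/
theorem integrable_exp_sum_abs {m : ℕ} {D : Fin m → Ω → ℝ}
    (hD : ∀ i, AEMeasurable (D i) μ)
    (hint : ∀ S : Fin m → ℝ, Integrable (fun ω => Real.exp (∑ i, S i * D i ω)) μ)
    (S : Fin m → ℝ) : Integrable (fun ω => Real.exp (∑ i, |S i * D i ω|)) μ := by
  have hb : Integrable (fun ω => ∑ e ∈ Fintype.piFinset (fun _ : Fin m => ({1, -1} : Finset ℝ)),
      Real.exp (∑ i, (e i * S i) * D i ω)) μ :=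
    integrable_finsetSum _ fun e _ => hint fun i => e i * S i
  refine hb.mono' ?_ (Eventually.of_forall fun ω => ?_)
  · exact (Real.measurable_exp.comp_aemeasurable
      (Finset.aemeasurable_fun_sum _ fun i _ => ((hD i).const_mul _).abs)).aestronglyMeasurable
  · rw [Real.norm_eq_abs, Real.abs_exp]
    let e : Fin m → ℝ := fun i => if 0 ≤ S i * D i ω then 1 else -1
    have he : ∑ i, |S i * D i ω| = ∑ i, (e i * S i) * D i ω := by
      refine Finset.sum_congr rfl fun i _ => ?_
      simp only [e]
      split_ifs with h
      · rw [abs_of_nonneg h]; ring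
      · rw [abs_of_neg (not_le.mp h)]; ring
    rw [he]
    refine Finset.single_le_sum (f := fun e : Fin m → ℝ => Real.exp (∑ i, (e i * S i) * D i ω))
      (fun _ _ => (Real.exp_pos _).le) ?_
    rw [Fintype.mem_piFinset]
    intro i
    simp only [e]
    split_ifs <;> simp

/-- The moments of a random vector with everywhere finite exponential moments are read off from
the power series of its moment generating function. -/
theorem integral_prod_pow_of_hasSum_mgf {m : ℕ} {D : Fin m → Ω → ℝ}
    (hD : ∀ i, AEMeasurable (D i) μ)
    (hint : ∀ S : Fin m → ℝ, Integrable (fun ω => Real.exp (∑ i, S i * D i ω)) μ)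
    {a : (Fin m → ℕ) → ℝ}
    (hmgf : ∀ S : Fin m → ℝ, HasSum (fun k => a k * ∏ i, S i ^ k i)
      (∫ ω, Real.exp (∑ i, S i * D i ω) ∂μ)) (k : Fin m → ℕ) :
    ∫ ω, ∏ i, D i ω ^ k i ∂μ = (∏ i, ((k i).factorial : ℝ)) * a k := by
  have hexp : ∀ S : Fin m → ℝ, HasSum
      (fun k : Fin m → ℕ => ∫ ω, ∏ i, ((S i * D i ω) ^ k i / (k i).factorial) ∂μ)
      (∫ ω, Real.exp (∑ i, S i * D i ω) ∂μ) := by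
    intro S
    refine hasSum_integral_of_dominated_convergence
      (fun k ω => ∏ i, (|S i * D i ω| ^ k i / (k i).factorial)) ?_ ?_ ?_ ?_ ?_
    · intro k
      exact (Finset.aemeasurable_fun_prod _ fun i _ =>
        (((hD i).const_mul _).pow_const _).div_const _).aestronglyMeasurable
    · intro k
      refine Eventually.of_forall fun ω => le_of_eq ?_
      simp [abs_mul]
    · exact Eventually.of_forall fun ω =>
        (hasSum_prod_pow_div_factorial fun i => |S i * D i ω|).summable
    · simp_rw [fun ω => (hasSum_prod_pow_div_factorial fun i => |S i * D i ω|).tsum_eq]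
      exact integrable_exp_sum_abs hD hint S
    · exact Eventually.of_forall fun ω => hasSum_prod_pow_div_factorial fun i => S i * D i ω
  -- Both series have the same sum for every `S`, so their difference has vanishing coefficients.
  have hzero := eq_zero_of_hasSum_prod_pow
    (a := fun k => (∫ ω, ∏ i, (D i ω ^ k i / (k i).factorial) ∂μ) - a k) (fun S => by
      have := (hexp S).sub (hmgf S)
      rw [sub_self] at this
      refine this.congr_fun fun k => ?_
      rw [sub_mul, ← integral_mul_const]
      congr 2
      ext ω
      rw [← Finset.prod_mul_distrib]
      refine Finset.prod_congr rfl fun i _ => ?_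
      rw [mul_pow]; ring) k
  rw [← sub_eq_zero.mp hzero, ← integral_const_mul]
  congr 1
  ext ω
  rw [← Finset.prod_mul_distrib]
  refine Finset.prod_congr rfl fun i _ => ?_
  have : ((k i).factorial : ℝ) ≠ 0 := by positivity
  field_simp

end Moments

/-! ### From values of the process to its increments -/

/-- The map from `s` to its tail sums is onto, so the variables `S` of the power series range freely
over all vectors. -/
theorem exists_sum_Ici_eq {m : ℕ} (S : Fin m → ℝ) :
    ∃ s : Fin m → ℝ, ∀ i, ∑ j ∈ Finset.Ici i, s j = S i := by
  induction m with
  | zero => exact ⟨S, fun i => i.elim0⟩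
  | succ m ih =>
    obtain ⟨s, hs⟩ := ih (fun i => S i.succ)
    refine ⟨Fin.cons (S 0 - ∑ j, s j) s, fun i => ?_⟩
    refine Fin.cases ?_ (fun i => ?_) i
    · have : Finset.Ici (0 : Fin (m + 1)) = Finset.univ := by ext; simp
      rw [this, Fin.sum_univ_succ]; simp
    · rw [Fin.sum_Ici_succ]; simpa using hs i

/-- Summation by parts: after exchanging the sums, the increments up to `j` telescope. -/
theorem sum_mul_sub_eq_sum_mul {m : ℕ} (s : Fin m → ℝ) (f : Fin (m + 1) → ℝ) :
    ∑ i, (∑ j ∈ Finset.Ici i, s j) * (f i.succ - f i.castSucc)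
      = ∑ j, s j * (f j.succ - f 0) := by
  simp_rw [← Fin.sum_Iic_sub, Finset.sum_mul, Finset.mul_sum]
  rw [Finset.sum_comm' (t' := Finset.univ) (s' := fun j => Finset.Iic j)]
  simp

namespace IsExpProcess

variable {Ω : Type*} [MeasurableSpace Ω] {μ : Measure Ω} {X : ℝ → Ω → ℝ} {lam b T : ℝ}

theorem sum_mul_ae_eq (hX : IsExpProcess μ X lam b T) {m : ℕ} {t : Fin (m + 1) → ℝ}
    (h0 : t 0 = 0) (s : Fin m → ℝ) :
    (fun ω => Real.exp (∑ i, (∑ j ∈ Finset.Ici i, s j) * (X (t i.succ) ω - X (t i.castSucc) ω)))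
      =ᵐ[μ] fun ω => Real.exp (∑ j, s j * X (t j.succ) ω) := by
  filter_upwards [hX.zero] with ω hω
  rw [sum_mul_sub_eq_sum_mul s (fun i => X (t i) ω)]
  simp [h0, hω]

theorem mem_Icc {m : ℕ} {t : Fin (m + 1) → ℝ} (h0 : t 0 = 0) (ht : StrictMono t)
    (hT : t (Fin.last m) ≤ T) (i : Fin (m + 1)) : t i ∈ Set.Icc 0 T :=
  ⟨h0 ▸ ht.monotone (Fin.zero_le i), (ht.monotone (Fin.le_last i)).trans hT⟩

theorem integrable_exp_sum_increments (hX : IsExpProcess μ X lam b T) {m : ℕ}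
    {t : Fin (m + 1) → ℝ} (h0 : t 0 = 0) (ht : StrictMono t) (hT : t (Fin.last m) ≤ T)
    (S : Fin m → ℝ) :
    Integrable (fun ω => Real.exp (∑ i, S i * (X (t i.succ) ω - X (t i.castSucc) ω))) μ := by
  obtain ⟨s, hs⟩ := exists_sum_Ici_eq S
  have := (hX.integrable_exp m t h0 ht hT s).congr (hX.sum_mul_ae_eq h0 s).symm
  simpa only [hs] using this

/-- The mixed moments of the increments of an exponential process. -/
theorem integral_prod_increments_pow (hX : IsExpProcess μ X lam b T) {m : ℕ}
    {t : Fin (m + 1) → ℝ} (h0 : t 0 = 0) (ht : StrictMono t) (hT : t (Fin.last m) ≤ T)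
    (k : Fin m → ℕ) :
    ∫ ω, ∏ i, (X (t i.succ) ω - X (t i.castSucc) ω) ^ k i ∂μ
      = (∏ i, ((k i).factorial : ℝ)) * ExpProcess.mgfCoeff lam b T t k := by
  refine integral_prod_pow_of_hasSum_mgf (D := fun i ω => X (t i.succ) ω - X (t i.castSucc) ω)
    (fun i => (hX.aemeasurable _ (mem_Icc h0 ht hT _)).sub
      (hX.aemeasurable _ (mem_Icc h0 ht hT _)))
    (hX.integrable_exp_sum_increments h0 ht hT) (fun S => ?_) k
  obtain ⟨s, hs⟩ := exists_sum_Ici_eq S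
  have := hX.hasSum_mgf m t h0 ht hT s
  rw [← integral_congr_ae (hX.sum_mul_ae_eq h0 s)] at this
  simpa only [hs] using this

/-- Exponential moments of every order give all power moments. Time `0` is separate, since the grids
in the definition are strictly increasing and their positive times exclude it. -/
theorem memLp [IsFiniteMeasure μ] (hX : IsExpProcess μ X lam b T) {t : ℝ} (ht : t ∈ Set.Icc 0 T)
    (n : ℕ) : MemLp (X t) n μ := by
  rcases ht.1.eq_or_lt with rfl | h0
  · exact (memLp_congr_ae hX.zero).mpr MemLp.zero
  · have : integrableExpSet (X t) μ = Set.univ := by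
      ext s
      have := hX.integrable_exp 1 ![0, t] rfl (by
        rw [Fin.strictMono_iff_lt_succ]; intro i; fin_cases i; simpa using h0)
        (by simpa using ht.2) ![s]
      simpa [integrableExpSet] using this
    exact memLp_of_mem_interior_integrableExpSet (by simp [this]) n

theorem memLp_increment [IsFiniteMeasure μ] (hX : IsExpProcess μ X lam b T) {d t : ℝ}
    (hd : 0 ≤ d) (hdt : d ≤ t) (ht : t ≤ T) (n : ℕ) : MemLp (increment X d t) n μ :=
  (hX.memLp ⟨hd.trans hdt, ht⟩ n).sub (hX.memLp ⟨by linarith, by linarith⟩ n)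

end IsExpProcess

/-! ### Factorization of the coefficients over the intervals -/

namespace ExpProcess

/-- The contribution of one time interval `(l, r)` with multiplicity `n` to the coefficient
`mgfCoeff`, with weight `exp (ρ y)` at the leftmost point and `exp (-σ x)` at the rightmost
point. -/
noncomputable def blockIntegral (l r : ℝ) (n : ℕ) (ρ σ : ℝ) : ℝ :=
  ∫ x in l..r, Real.exp (-σ * x) *
    if 2 ≤ n then ∫ y in l..x, (x - y) ^ (n - 2) / ((n - 2).factorial : ℝ) * Real.exp (ρ * y)
    else Real.exp (ρ * x)

/-- Rewrites a product over `C₂` as one over `C`, so that the factors of each interval can be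
collected. -/
theorem prod_dite_mem {ι : Type*} [DecidableEq ι] {s u : Finset ι} (h : ∀ i ∈ u, i ∈ s)
    (g : u → ℝ) :
    (∏ i : s, if hi : i.1 ∈ u then g ⟨i.1, hi⟩ else 1) = ∏ i : u, g i := by
  rw [← Finset.prod_subset (Finset.subset_univ
    ((Finset.univ : Finset u).image fun i => (⟨i.1, h _ i.2⟩ : s)))]
  · rw [Finset.prod_image (g := fun i : u => (⟨i.1, h _ i.2⟩ : s)) fun a _ b _ hab =>
      Subtype.ext (congrArg (fun z : s => z.1) hab)]
    simp
  · intro x _ hx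
    rw [dif_neg]
    intro hxu
    exact hx (Finset.mem_image.mpr ⟨⟨x.1, hxu⟩, Finset.mem_univ _, rfl⟩)

section Region

variable {m : ℕ} {t : Fin (m + 1) → ℝ} {k : Fin m → ℕ}

theorem measurableSet_region : MeasurableSet (region t k) := by
  refine MeasurableSet.inter (s₁ := {p : Pts k | ∀ i : supp k,
    t i.1.castSucc < p.1 i ∧ p.1 i < t i.1.succ}) (s₂ := {p : Pts k | ∀ i : supp₂ k,
    t i.1.castSucc < p.2 i ∧ p.2 i < p.1 ⟨i.1, supp₂_subset k i.2⟩}) ?_ ?_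
  · simp only [Set.ofPred_forall, Set.ofPred_and]
    exact MeasurableSet.iInter fun i => (measurableSet_lt (by fun_prop) (by fun_prop)).inter
      (measurableSet_lt (by fun_prop) (by fun_prop))
  · simp only [Set.ofPred_forall, Set.ofPred_and]
    exact MeasurableSet.iInter fun i => (measurableSet_lt (by fun_prop) (by fun_prop)).inter
      (measurableSet_lt (by fun_prop) (by fun_prop))

theorem continuous_leftPt (i : supp k) : Continuous fun p : Pts k => leftPt p i := by
  unfold leftPt
  split_ifs <;> fun_prop

theorem integrableOn_region {F : Pts k → ℝ} (hF : Continuous F) : IntegrableOn F (region t k) := by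
  let lo : Pts k := (fun i => t i.1.castSucc, fun i => t i.1.castSucc)
  let hi : Pts k := (fun i => t i.1.succ, fun i => t i.1.succ)
  refine (hF.continuousOn.integrableOn_compact (isCompact_Icc (a := lo) (b := hi))).mono_set ?_
  rintro p ⟨h1, h2⟩
  refine ⟨⟨fun i => (h1 i).1.le, fun i => (h2 i).1.le⟩,
    ⟨fun i => (h1 i).2.le, fun i => ((h2 i).2.trans (h1 _).2).le⟩⟩

/-- The spread involves one rightmost and one leftmost point only. Weights that vanish off the last,
respectively first, index make the exponential a product over all of `C`; when these indices agree,
one block carries both weights. -/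
theorem exp_spread_eq (hk : k ≠ 0) (lam : ℝ) (p : Pts k) :
    Real.exp (-lam * spread hk p)
      = (∏ i : supp k, Real.exp
          (-(if i.1 = (supp k).max' (supp_nonempty hk) then lam else 0) * p.1 i))
        * ∏ i : supp k, Real.exp
          ((if i.1 = (supp k).min' (supp_nonempty hk) then lam else 0) * leftPt p i) := by
  rw [← Real.exp_sum, ← Real.exp_sum, ← Real.exp_add]
  congr 1
  rw [Finset.sum_eq_single (⟨(supp k).max' (supp_nonempty hk), Finset.max'_mem _ _⟩ : supp k),
    Finset.sum_eq_single (⟨(supp k).min' (supp_nonempty hk), Finset.min'_mem _ _⟩ : supp k)]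
  · simp only [if_true, spread]; ring
  · intro j _ hj
    rw [if_neg fun h => hj (Subtype.ext h), zero_mul]
  · simp
  · intro j _ hj
    rw [if_neg fun h => hj (Subtype.ext h), neg_zero, zero_mul]
  · simp

/-- The weight of the `i`-th interval as a function of its rightmost point. -/
noncomputable def outerWeight (t : Fin (m + 1) → ℝ) (k : Fin m → ℕ) (ρ σ : Fin m → ℝ)
    (i : Fin m) (x : ℝ) : ℝ :=
  (Set.Ioo (t i.castSucc) (t i.succ)).indicator
    (fun x => Real.exp (-σ i * x) * if i ∈ supp₂ k then 1 else Real.exp (ρ i * x)) x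

/-- The weight of the `i`-th interval as a function of its leftmost point `y`, given its rightmost
point `x`. -/
noncomputable def innerWeight (t : Fin (m + 1) → ℝ) (k : Fin m → ℕ) (ρ : Fin m → ℝ)
    (i : Fin m) (x y : ℝ) : ℝ :=
  (Set.Ioo (t i.castSucc) x).indicator
    (fun y => (x - y) ^ (k i - 2) / ((k i - 2).factorial : ℝ) * Real.exp (ρ i * y)) y

/-- The constraints on `x_i` and `x_i'` concern a single interval, so the indicator factorizes along
with the integrand. The factor at the leftmost point belongs to `innerWeight` when `i ∈ C₂` and to
`outerWeight` otherwise. -/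
theorem indicator_region_eq (ρ σ : Fin m → ℝ) (p : Pts k) :
    (region t k).indicator (fun p : Pts k =>
      (∏ i : supp₂ k, (p.1 ⟨i.1, supp₂_subset k i.2⟩ - p.2 i) ^ (k i.1 - 2)
          / (Nat.factorial (k i.1 - 2) : ℝ))
        * ((∏ i : supp k, Real.exp (-σ i.1 * p.1 i))
          * ∏ i : supp k, Real.exp (ρ i.1 * leftPt p i))) p
      = (∏ i : supp k, outerWeight t k ρ σ i.1 (p.1 i))
        * ∏ i : supp₂ k, innerWeight t k ρ i.1 (p.1 ⟨i.1, supp₂_subset k i.2⟩) (p.2 i) := by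
  by_cases hp : p ∈ region t k
  · have h1 : ∀ i : supp k, outerWeight t k ρ σ i.1 (p.1 i) = Real.exp (-σ i.1 * p.1 i) *
        if i.1 ∈ supp₂ k then 1 else Real.exp (ρ i.1 * p.1 i) :=
      fun i => Set.indicator_of_mem (s := Set.Ioo _ _) (hp.1 i) _
    have h2 : ∀ i : supp₂ k, innerWeight t k ρ i.1 (p.1 ⟨i.1, supp₂_subset k i.2⟩) (p.2 i)
        = (p.1 ⟨i.1, supp₂_subset k i.2⟩ - p.2 i) ^ (k i.1 - 2)
          / (Nat.factorial (k i.1 - 2) : ℝ) * Real.exp (ρ i.1 * p.2 i) :=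
      fun i => Set.indicator_of_mem (s := Set.Ioo _ _) (hp.2 i) _
    have h3 : ∏ i : supp k, Real.exp (ρ i.1 * leftPt p i)
        = (∏ i : supp k, if i.1 ∈ supp₂ k then 1 else Real.exp (ρ i.1 * p.1 i))
          * ∏ i : supp₂ k, Real.exp (ρ i.1 * p.2 i) := by
      rw [← prod_dite_mem (fun i hi => supp₂_subset k hi) fun i : supp₂ k =>
        Real.exp (ρ i.1 * p.2 i), ← Finset.prod_mul_distrib]
      refine Finset.prod_congr rfl fun i _ => ?_
      unfold leftPt
      split_ifs <;> simp
    rw [Set.indicator_of_mem hp, Finset.prod_congr rfl fun i _ => h1 i,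
      Finset.prod_congr rfl fun i _ => h2 i, Finset.prod_mul_distrib, Finset.prod_mul_distrib, h3]
    ring
  · rw [Set.indicator_of_notMem hp]
    simp only [region, Set.mem_ofPred_eq, not_and_or, not_forall] at hp
    rcases hp with ⟨i, hi⟩ | ⟨i, hi⟩
    · rw [Finset.prod_eq_zero (Finset.mem_univ i), zero_mul]
      exact Set.indicator_of_notMem (by rwa [Set.mem_Ioo, not_and_or]) _
    · rw [mul_comm, Finset.prod_eq_zero (Finset.mem_univ i), zero_mul]
      exact Set.indicator_of_notMem (by rwa [Set.mem_Ioo, not_and_or]) _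

theorem integral_outerWeight_mul (ht : StrictMono t) (ρ σ : Fin m → ℝ) (i : Fin m) :
    ∫ x, outerWeight t k ρ σ i x * (if i ∈ supp₂ k then ∫ y, innerWeight t k ρ i x y else 1)
      = blockIntegral (t i.castSucc) (t i.succ) (k i) (ρ i) (σ i) := by
  have hle : t i.castSucc ≤ t i.succ := (ht Fin.castSucc_lt_succ).le
  have h2 : i ∈ supp₂ k ↔ 2 ≤ k i := by simp [supp₂]
  rw [blockIntegral, intervalIntegral.integral_of_le hle, integral_Ioc_eq_integral_Ioo,
    ← integral_indicator measurableSet_Ioo]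
  congr 1
  ext x
  by_cases hx : x ∈ Set.Ioo (t i.castSucc) (t i.succ)
  · rw [outerWeight, Set.indicator_of_mem hx, Set.indicator_of_mem hx]
    simp only [h2]
    split_ifs with h
    · rw [intervalIntegral.integral_of_le hx.1.le, integral_Ioc_eq_integral_Ioo,
        ← integral_indicator measurableSet_Ioo, mul_one]
      rfl
    · rw [mul_one]
  · rw [outerWeight, Set.indicator_of_notMem hx, Set.indicator_of_notMem hx, zero_mul]

/-- The integral over the region factorizes over the time intervals. -/
theorem integral_region_eq (ht : StrictMono t) (hk : k ≠ 0) (lam : ℝ) :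
    ∫ p in region t k, (∏ i : supp₂ k,
        (p.1 ⟨i.1, supp₂_subset k i.2⟩ - p.2 i) ^ (k i.1 - 2) / (Nat.factorial (k i.1 - 2) : ℝ))
      * Real.exp (-lam * spread hk p)
      = ∏ i ∈ supp k, blockIntegral (t i.castSucc) (t i.succ) (k i)
          (if i = (supp k).min' (supp_nonempty hk) then lam else 0)
          (if i = (supp k).max' (supp_nonempty hk) then lam else 0) := by
  simp_rw [exp_spread_eq hk lam]
  set ρ : Fin m → ℝ := fun i => if i = (supp k).min' (supp_nonempty hk) then lam else 0
  set σ : Fin m → ℝ := fun i => if i = (supp k).max' (supp_nonempty hk) then lam else 0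
  have hcont : Continuous fun p : Pts k =>
      (∏ i : supp₂ k, (p.1 ⟨i.1, supp₂_subset k i.2⟩ - p.2 i) ^ (k i.1 - 2)
          / (Nat.factorial (k i.1 - 2) : ℝ))
        * ((∏ i : supp k, Real.exp (-σ i.1 * p.1 i))
          * ∏ i : supp k, Real.exp (ρ i.1 * leftPt p i)) := by
    have := fun i : supp k => continuous_leftPt (k := k) i
    fun_prop
  have hint := (integrable_indicator_iff measurableSet_region).mpr
    (integrableOn_region (t := t) hcont)
  rw [← integral_indicator measurableSet_region]
  rw [show (region t k).indicator (fun p : Pts k =>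
      (∏ i : supp₂ k, (p.1 ⟨i.1, supp₂_subset k i.2⟩ - p.2 i) ^ (k i.1 - 2)
          / (Nat.factorial (k i.1 - 2) : ℝ))
        * ((∏ i : supp k, Real.exp (-σ i.1 * p.1 i))
          * ∏ i : supp k, Real.exp (ρ i.1 * leftPt p i)))
      = fun p => _ from funext (indicator_region_eq ρ σ)] at hint ⊢
  -- Fubini: for fixed `x` the `x'`-integral is a product of one-dimensional integrals, each
  -- depending on a single `x_i`; the remaining `x`-integral then factorizes too.
  rw [Measure.volume_eq_prod, integral_prod _ hint]
  simp only [integral_const_mul]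
  have hin : ∀ x : supp k → ℝ, ∫ y : supp₂ k → ℝ, ∏ i : supp₂ k,
      innerWeight t k ρ i.1 (x ⟨i.1, supp₂_subset k i.2⟩) (y i)
      = ∏ i : supp₂ k, ∫ y, innerWeight t k ρ i.1 (x ⟨i.1, supp₂_subset k i.2⟩) y :=
    fun x => integral_fintype_prod_volume_eq_prod fun (i : supp₂ k) (y : ℝ) =>
      innerWeight t k ρ i.1 (x ⟨i.1, supp₂_subset k i.2⟩) y
  simp only [hin]
  change _ = ∏ i ∈ supp k, blockIntegral (t i.castSucc) (t i.succ) (k i) (ρ i) (σ i)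
  rw [← Finset.prod_coe_sort]
  simp_rw [← integral_outerWeight_mul ht ρ σ]
  rw [← integral_fintype_prod_volume_eq_prod fun (i : supp k) (x : ℝ) =>
    outerWeight t k ρ σ i.1 x * (if i.1 ∈ supp₂ k then ∫ y, innerWeight t k ρ i.1 x y else 1)]
  congr 1
  ext x
  rw [Finset.prod_mul_distrib]
  congr 1
  rw [← prod_dite_mem fun i hi => supp₂_subset k hi]
  rfl

/-- Replaces the abstract minimum and maximum of `C` by indices known in the applications. -/
theorem mgfCoeff_eq_prod (ht : StrictMono t) {i₀ i₁ : Fin m} (h0 : k i₀ ≠ 0) (h1 : k i₁ ≠ 0)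
    (hle : ∀ j, k j ≠ 0 → i₀ ≤ j ∧ j ≤ i₁) (lam b T : ℝ) :
    mgfCoeff lam b T t k = b * Real.exp (-lam * T) *
      ∏ i ∈ supp k, blockIntegral (t i.castSucc) (t i.succ) (k i)
        (if i = i₀ then lam else 0) (if i = i₁ then lam else 0) := by
  have hk : k ≠ 0 := fun h => h0 (congrFun h i₀)
  have hmem : ∀ j, j ∈ supp k ↔ k j ≠ 0 := by simp [supp, Nat.one_le_iff_ne_zero]
  have hmin : (supp k).min' (supp_nonempty hk) = i₀ :=
    le_antisymm (Finset.min'_le _ _ ((hmem _).mpr h0))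
      (hle _ ((hmem _).mp (Finset.min'_mem _ _))).1
  have hmax : (supp k).max' (supp_nonempty hk) = i₁ :=
    le_antisymm (hle _ ((hmem _).mp (Finset.max'_mem _ _))).2
      (Finset.le_max' _ _ ((hmem _).mpr h1))
  rw [mgfCoeff, dif_neg hk, integral_region_eq ht hk, hmin, hmax]

end Region

/-! ### Bounds and exact values of block integrals -/

theorem integral_sub_pow_div_factorial (l r : ℝ) (n : ℕ) :
    ∫ x in l..r, (x - l) ^ n / (n.factorial : ℝ) = (r - l) ^ (n + 1) / ((n + 1).factorial : ℝ) := by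
  rw [intervalIntegral.integral_div, intervalIntegral.integral_comp_sub_right (fun x => x ^ n) l,
    integral_pow, Nat.factorial_succ]
  have : (n.factorial : ℝ) ≠ 0 := by positivity
  push_cast
  simp
  field_simp

theorem integral_sub_left_pow_div_factorial (l x : ℝ) (n : ℕ) :
    ∫ y in l..x, (x - y) ^ n / (n.factorial : ℝ) = (x - l) ^ (n + 1) / ((n + 1).factorial : ℝ) := by
  rw [intervalIntegral.integral_div, intervalIntegral.integral_comp_sub_left (fun x => x ^ n) x,
    integral_pow, Nat.factorial_succ]
  have : (n.factorial : ℝ) ≠ 0 := by positivity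
  push_cast
  simp
  field_simp

theorem continuous_inner_integral (l ρ : ℝ) (n : ℕ) : Continuous fun x : ℝ =>
    ∫ y in l..x, (x - y) ^ n / (n.factorial : ℝ) * Real.exp (ρ * y) :=
  intervalIntegral.continuous_parametric_intervalIntegral_of_continuous
    (f := fun x y => (x - y) ^ n / (n.factorial : ℝ) * Real.exp (ρ * y))
    (by unfold Function.uncurry; fun_prop) continuous_id

theorem continuous_block_integrand (l : ℝ) (n : ℕ) (ρ σ : ℝ) : Continuous fun x : ℝ =>
    Real.exp (-σ * x) *
      if 2 ≤ n then ∫ y in l..x, (x - y) ^ (n - 2) / ((n - 2).factorial : ℝ) * Real.exp (ρ * y)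
      else Real.exp (ρ * x) := by
  have := continuous_inner_integral l ρ (n - 2)
  split_ifs <;> fun_prop

/-- Since `ρ` and `σ` are nonnegative, the weights are monotone and bounded by their values at `l`
and `r`. Without weights, two integrations of `(x - y) ^ (n - 2) / (n - 2)!` give `(r - l) ^ n /
n!`; for `n = 1` only the outer one is present. -/
theorem blockIntegral_bounds {l r : ℝ} (hlr : l ≤ r) {n : ℕ} (hn : n ≠ 0) {ρ σ : ℝ}
    (hρ : 0 ≤ ρ) (hσ : 0 ≤ σ) :
    Real.exp (ρ * l - σ * r) * ((r - l) ^ n / (n.factorial : ℝ)) ≤ blockIntegral l r n ρ σ ∧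
    blockIntegral l r n ρ σ ≤ Real.exp (ρ * r - σ * l) * ((r - l) ^ n / (n.factorial : ℝ)) := by
  obtain ⟨n, rfl⟩ := Nat.exists_eq_succ_of_ne_zero hn
  have hinner : ∀ x ∈ Set.Icc l r,
      Real.exp (ρ * l) * ((x - l) ^ n / (n.factorial : ℝ)) ≤
        (if 2 ≤ n + 1 then ∫ y in l..x, (x - y) ^ (n + 1 - 2) / ((n + 1 - 2).factorial : ℝ)
          * Real.exp (ρ * y) else Real.exp (ρ * x)) ∧
        (if 2 ≤ n + 1 then ∫ y in l..x, (x - y) ^ (n + 1 - 2) / ((n + 1 - 2).factorial : ℝ)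
          * Real.exp (ρ * y) else Real.exp (ρ * x)) ≤
      Real.exp (ρ * r) * ((x - l) ^ n / (n.factorial : ℝ)) := by
    intro x hx
    rcases n with _ | n
    · simp only [zero_add, Nat.not_ofNat_le_one, if_false, pow_zero, Nat.factorial_zero,
        Nat.cast_one, div_one, mul_one, Real.exp_le_exp]
      exact ⟨mul_le_mul_of_nonneg_left hx.1 hρ, mul_le_mul_of_nonneg_left hx.2 hρ⟩
    · rw [if_pos (by omega), show n + 1 + 1 - 2 = n by omega,
        ← integral_sub_left_pow_div_factorial, ← intervalIntegral.integral_const_mul,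
        ← intervalIntegral.integral_const_mul]
      have hnn : ∀ y ∈ Set.Icc l x, 0 ≤ (x - y) ^ n / (n.factorial : ℝ) := fun y hy => by
        have := sub_nonneg.mpr hy.2
        positivity
      constructor
      · refine intervalIntegral.integral_mono_on hx.1
          (Continuous.intervalIntegrable (by fun_prop) _ _)
          (Continuous.intervalIntegrable (by fun_prop) _ _) fun y hy => ?_
        rw [mul_comm]
        exact mul_le_mul_of_nonneg_left
          (Real.exp_le_exp.mpr (mul_le_mul_of_nonneg_left hy.1 hρ)) (hnn y hy)
      · refine intervalIntegral.integral_mono_on hx.1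
          (Continuous.intervalIntegrable (by fun_prop) _ _)
          (Continuous.intervalIntegrable (by fun_prop) _ _) fun y hy => ?_
        rw [mul_comm (Real.exp _)]
        exact mul_le_mul_of_nonneg_left
          (Real.exp_le_exp.mpr (mul_le_mul_of_nonneg_left (hy.2.trans hx.2) hρ)) (hnn y hy)
  have hcont := continuous_block_integrand l (n + 1) ρ σ
  rw [Nat.succ_eq_add_one, ← integral_sub_pow_div_factorial, ← intervalIntegral.integral_const_mul,
    ← intervalIntegral.integral_const_mul, blockIntegral]
  constructor
  · refine intervalIntegral.integral_mono_on hlr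
      (Continuous.intervalIntegrable (by fun_prop) _ _) (hcont.intervalIntegrable _ _)
      fun x hx => ?_
    rw [show ρ * l - σ * r = -σ * r + ρ * l by ring, Real.exp_add, mul_assoc]
    have h1 : Real.exp (-σ * r) ≤ Real.exp (-σ * x) := Real.exp_le_exp.mpr (by nlinarith [hx.2])
    have hx0 := sub_nonneg.mpr hx.1
    exact mul_le_mul h1 (hinner x hx).1 (by positivity) (by positivity)
  · refine intervalIntegral.integral_mono_on hlr (hcont.intervalIntegrable _ _)
      (Continuous.intervalIntegrable (by fun_prop) _ _) fun x hx => ?_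
    rw [show ρ * r - σ * l = -σ * l + ρ * r by ring, Real.exp_add, mul_assoc]
    have h1 : Real.exp (-σ * x) ≤ Real.exp (-σ * l) := Real.exp_le_exp.mpr (by nlinarith [hx.1])
    have hx0 := sub_nonneg.mpr hx.1
    refine mul_le_mul h1 (hinner x hx).2 (le_trans ?_ (hinner x hx).1) (by positivity)
    positivity

theorem integral_exp_mul {a : ℝ} (ha : a ≠ 0) (l r : ℝ) :
    ∫ x in l..r, Real.exp (a * x) = (Real.exp (a * r) - Real.exp (a * l)) / a := by
  rw [intervalIntegral.integral_comp_mul_left _ ha, integral_exp, smul_eq_mul, inv_mul_eq_div]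

theorem blockIntegral_one_same (l r lam : ℝ) : blockIntegral l r 1 lam lam = r - l := by
  simp [blockIntegral, ← Real.exp_add]

theorem blockIntegral_one_left (l r : ℝ) {lam : ℝ} (h : lam ≠ 0) :
    blockIntegral l r 1 lam 0 = (Real.exp (lam * r) - Real.exp (lam * l)) / lam := by
  simp [blockIntegral, integral_exp_mul h]

theorem blockIntegral_one_right (l r : ℝ) {lam : ℝ} (h : lam ≠ 0) :
    blockIntegral l r 1 0 lam = (Real.exp (-lam * l) - Real.exp (-lam * r)) / lam := by
  have := integral_exp_mul (neg_ne_zero.mpr h) l r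
  simp only [blockIntegral, Nat.not_ofNat_le_one, if_false, zero_mul, Real.exp_zero, mul_one, this]
  field_simp
  ring

theorem blockIntegral_two_same (l r : ℝ) {lam : ℝ} (h : lam ≠ 0) :
    blockIntegral l r 2 lam lam
      = (r - l) / lam - (1 - Real.exp (-lam * (r - l))) / lam ^ 2 := by
  have h1 : ∀ x, Real.exp (-lam * x) * ((Real.exp (lam * x) - Real.exp (lam * l)) / lam)
      = 1 / lam - Real.exp (lam * l) / lam * Real.exp (-lam * x) := by
    intro x
    have : Real.exp (-lam * x) * Real.exp (lam * x) = 1 := by rw [← Real.exp_add]; simp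
    rw [neg_mul] at *
    field_simp
    linear_combination this
  simp only [blockIntegral, le_refl, if_true, Nat.sub_self, pow_zero, Nat.factorial_zero,
    Nat.cast_one, div_one, one_mul, integral_exp_mul h, h1]
  rw [intervalIntegral.integral_sub (by simp) (Continuous.intervalIntegrable (by fun_prop) _ _),
    intervalIntegral.integral_const_mul, integral_exp_mul (neg_ne_zero.mpr h)]
  have h2 : Real.exp (-lam * (r - l)) = Real.exp (lam * l) * Real.exp (-lam * r) := by
    rw [← Real.exp_add]; ring_nf
  have h3 : Real.exp (lam * l) * Real.exp (-lam * l) = 1 := by rw [← Real.exp_add]; simp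
  rw [h2, intervalIntegral.integral_const, smul_eq_mul]
  simp only [neg_mul] at *
  generalize Real.exp (lam * l) = A at *
  generalize Real.exp (-(lam * l)) = B at *
  field_simp
  linear_combination -h3

end ExpProcess

/-! ### Two-sided bounds for mixed moments and their small-length limits -/

namespace IsExpProcess

variable {Ω : Type*} [MeasurableSpace Ω] {μ : Measure Ω} {X : ℝ → Ω → ℝ} {lam b T : ℝ}

/-- Two-sided bounds for the mixed moments of the increments over a grid of times; `i₀` and `i₁` are
the first and the last interval that occur. -/
theorem integral_prod_increments_pow_bounds (hX : IsExpProcess μ X lam b T) (hlam : 0 ≤ lam)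
    (hb : 0 ≤ b) {m : ℕ} {t : Fin (m + 1) → ℝ} (h0 : t 0 = 0) (ht : StrictMono t)
    (hT : t (Fin.last m) ≤ T) {k : Fin m → ℕ} {i₀ i₁ : Fin m} (hk0 : k i₀ ≠ 0) (hk1 : k i₁ ≠ 0)
    (hle : ∀ j, k j ≠ 0 → i₀ ≤ j ∧ j ≤ i₁) :
    b * Real.exp (-lam * T) * (Real.exp (lam * (t i₀.castSucc - t i₁.succ))
        * ∏ i, (t i.succ - t i.castSucc) ^ k i)
      ≤ ∫ ω, ∏ i, (X (t i.succ) ω - X (t i.castSucc) ω) ^ k i ∂μ ∧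
    ∫ ω, ∏ i, (X (t i.succ) ω - X (t i.castSucc) ω) ^ k i ∂μ
      ≤ b * Real.exp (-lam * T) * (Real.exp (lam * (t i₀.succ - t i₁.castSucc))
        * ∏ i, (t i.succ - t i.castSucc) ^ k i) := by
  rw [hX.integral_prod_increments_pow h0 ht hT, ExpProcess.mgfCoeff_eq_prod ht hk0 hk1 hle,
    mul_left_comm (∏ i, ((k i).factorial : ℝ))]
  have hmem : ∀ j, j ∈ ExpProcess.supp k ↔ k j ≠ 0 := by
    simp [ExpProcess.supp, Nat.one_le_iff_ne_zero]
  -- Intervals of multiplicity zero contribute the factor `1`, so full products may be restricted to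
  -- the support.
  have hsub : ∀ {f : Fin m → ℝ}, (∀ i, k i = 0 → f i = 1) →
      ∏ i, f i = ∏ i ∈ ExpProcess.supp k, f i := fun {f} hf =>
    (Finset.prod_subset (Finset.subset_univ _) fun i _ hi => hf i (by simpa [hmem] using hi)).symm
  have hexp : ∀ x y : Fin m → ℝ, Real.exp (lam * (x i₀ - y i₁)) = ∏ i ∈ ExpProcess.supp k,
      Real.exp ((if i = i₀ then lam else 0) * x i - (if i = i₁ then lam else 0) * y i) := by
    intro x y
    rw [← Real.exp_sum, Finset.sum_sub_distrib]
    simp [ite_mul, hmem, hk0, hk1, mul_sub]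
  have hc : 0 ≤ b * Real.exp (-lam * T) := by positivity
  have hlt : ∀ i : Fin m, t i.castSucc < t i.succ := fun i => ht Fin.castSucc_lt_succ
  have hbd := fun i (hi : i ∈ ExpProcess.supp k) => ExpProcess.blockIntegral_bounds (hlt i).le
    ((hmem i).mp hi) (ρ := if i = i₀ then lam else 0) (σ := if i = i₁ then lam else 0)
    (by split_ifs <;> simp [hlam]) (by split_ifs <;> simp [hlam])
  have hfac : ∀ i, (0 : ℝ) < (k i).factorial := fun i => by positivity
  have hpow : ∀ i, 0 ≤ (t i.succ - t i.castSucc) ^ k i := fun i =>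
    pow_nonneg (sub_nonneg.mpr (hlt i).le) _
  rw [hsub (f := fun i => (t i.succ - t i.castSucc) ^ k i) (fun i hi => by simp [hi]),
    hsub (f := fun i => ((k i).factorial : ℝ)) (fun i hi => by simp [hi]),
    hexp (fun i => t i.castSucc) (fun i => t i.succ),
    hexp (fun i => t i.succ) (fun i => t i.castSucc), ← Finset.prod_mul_distrib,
    ← Finset.prod_mul_distrib, ← Finset.prod_mul_distrib]
  constructor
  · refine mul_le_mul_of_nonneg_left (Finset.prod_le_prod
      (fun i _ => mul_nonneg (Real.exp_pos _).le (hpow i)) fun i hi => ?_) hc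
    refine le_trans (le_of_eq ?_) (mul_le_mul_of_nonneg_left (hbd i hi).1 (hfac i).le)
    have := (hfac i).ne'
    field_simp
  · refine mul_le_mul_of_nonneg_left (Finset.prod_le_prod
      (fun i hi => mul_nonneg (hfac i).le (le_trans ?_ (hbd i hi).1)) fun i hi => ?_) hc
    · exact mul_nonneg (Real.exp_pos _).le (div_nonneg (hpow i) (hfac i).le)
    · refine le_trans (mul_le_mul_of_nonneg_left (hbd i hi).2 (hfac i).le) (le_of_eq ?_)
      have := (hfac i).ne'
      field_simp

end IsExpProcess

theorem prod_univ_fin_mul_two {M : Type*} [CommMonoid M] (n : ℕ) (f : ℕ → M) :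
    ∏ j : Fin (n * 2), f j = ∏ i : Fin n, f (2 * i) * f (2 * i + 1) := by
  rw [Fin.prod_univ_eq_prod_range f, Fin.prod_univ_eq_prod_range fun i => f (2 * i) * f (2 * i + 1)]
  induction n with
  | zero => simp
  | succ n ih =>
    rw [Nat.succ_mul, Finset.prod_range_succ, Finset.prod_range_succ, ih,
      Finset.prod_range_succ, mul_comm n 2, mul_assoc]

/-- The grid `0, t 0 - d, t 0, t 1 - d, t 1, …`. -/
noncomputable def pairGrid (t : ℕ → ℝ) (d : ℝ) (j : ℕ) : ℝ :=
  if j = 0 then 0 else if j % 2 = 1 then t (j / 2) - d else t (j / 2 - 1)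

theorem pairGrid_odd (t : ℕ → ℝ) (d : ℝ) (i : ℕ) : pairGrid t d (2 * i + 1) = t i - d := by
  rw [pairGrid, if_neg (by omega), if_pos (by omega), show (2 * i + 1) / 2 = i by omega]

theorem pairGrid_even (t : ℕ → ℝ) (d : ℝ) (i : ℕ) : pairGrid t d (2 * i + 2) = t i := by
  rw [pairGrid, if_neg (by omega), if_neg (by omega), show (2 * i + 2) / 2 - 1 = i by omega]

namespace IsExpProcess

variable {Ω : Type*} [MeasurableSpace Ω] {μ : Measure Ω} {X : ℝ → Ω → ℝ} {lam b T : ℝ}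

/-- Two-sided bounds for the mixed moments of short increments at separated times. -/
theorem integral_prod_increment_pow_bounds (hX : IsExpProcess μ X lam b T) (hlam : 0 ≤ lam)
    (hb : 0 ≤ b) {m : ℕ} {t : Fin (m + 1) → ℝ} (hT : t (Fin.last m) ≤ T)
    {k : Fin (m + 1) → ℕ} (hk : ∀ i, 1 ≤ k i) {d : ℝ} (hd : 0 < d) (hd0 : d < t 0)
    (hdt : ∀ i : Fin m, d < t i.succ - t i.castSucc) :
    b * Real.exp (-lam * T) * (Real.exp (-lam * (t (Fin.last m) - t 0)) * Real.exp (-(lam * d)))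
        * d ^ (∑ i, k i) ≤ ∫ ω, ∏ i, increment X d (t i) ω ^ k i ∂μ ∧
    ∫ ω, ∏ i, increment X d (t i) ω ^ k i ∂μ
      ≤ b * Real.exp (-lam * T) * (Real.exp (-lam * (t (Fin.last m) - t 0)) * Real.exp (lam * d))
        * d ^ (∑ i, k i) := by
  obtain ⟨t', ht'⟩ : ∃ t' : ℕ → ℝ, ∀ i : Fin (m + 1), t' i = t i :=
    ⟨fun n => if h : n < m + 1 then t ⟨n, h⟩ else 0, fun i => dif_pos i.2⟩
  obtain ⟨k', hk'⟩ : ∃ k' : ℕ → ℕ, ∀ i : Fin (m + 1), k' i = k i :=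
    ⟨fun n => if h : n < m + 1 then k ⟨n, h⟩ else 0, fun i => dif_pos i.2⟩
  let g : Fin ((m + 1) * 2 + 1) → ℝ := fun j => pairGrid t' d j
  -- The odd intervals are the increments `(t i - d, t i)`; the even ones are the gaps, with
  -- multiplicity `0`. Hence the first and last intervals that occur are `1` and `2 * m + 1`.
  let q : Fin ((m + 1) * 2) → ℕ := fun j => if j.1 % 2 = 1 then k' (j.1 / 2) else 0
  have hg : StrictMono g := by
    rw [Fin.strictMono_iff_lt_succ]
    rintro ⟨j, hj⟩
    simp only [g, Fin.castSucc_mk, Fin.succ_mk]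
    rcases Nat.even_or_odd' j with ⟨i, rfl | rfl⟩
    · rw [pairGrid_odd]
      rcases i with _ | i
      · have := ht' 0
        simp only [Fin.val_zero] at this
        rw [this]
        simpa [pairGrid] using hd0
      · rw [show 2 * (i + 1) = 2 * i + 2 by ring, pairGrid_even]
        have h1 := ht' (⟨i, by omega⟩ : Fin m).succ
        have h2 := ht' (⟨i, by omega⟩ : Fin m).castSucc
        simp only [Fin.succ_mk, Fin.castSucc_mk] at h1 h2
        have h3 := hdt ⟨i, by omega⟩
        simp only [Fin.succ_mk, Fin.castSucc_mk] at h3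
        rw [h1, h2]
        linarith
    · rw [pairGrid_odd, pairGrid_even]
      linarith
  have hgl : g (Fin.last _) = t (Fin.last m) := by
    simp only [g, Fin.val_last]
    rw [show (m + 1) * 2 = 2 * m + 2 by ring, pairGrid_even, ← ht']
    rfl
  have hqo : ∀ i : Fin (m + 1), ∀ h, q ⟨2 * i + 1, h⟩ = k i := by
    intro i h
    simp only [q]
    rw [if_pos (by omega), show (2 * i.1 + 1) / 2 = i by omega, hk']
  have hprod : ∀ f : ℝ → ℝ → ℝ, ∏ j, f (g j.succ) (g j.castSucc) ^ q j
      = ∏ i, f (t i) (t i - d) ^ k i := by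
    intro f
    have := prod_univ_fin_mul_two (m + 1) fun j =>
      f (pairGrid t' d (j + 1)) (pairGrid t' d j) ^ (if j % 2 = 1 then k' (j / 2) else 0)
    simp only [g, q, Fin.val_succ, Fin.val_castSucc]
    rw [this]
    refine Finset.prod_congr rfl fun i _ => ?_
    rw [if_neg (by omega), if_pos (by omega), pow_zero, one_mul, pairGrid_odd, pairGrid_even,
      show (2 * i.1 + 1) / 2 = i by omega, ht', hk']
  have hB := hX.integral_prod_increments_pow_bounds hlam hb (t := g) (k := q) (by simp [g, pairGrid])
    hg (hgl.le.trans hT) (i₀ := ⟨1, by omega⟩) (i₁ := ⟨2 * m + 1, by omega⟩)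
    (by
      have h1 := hqo 0 (by simp only [Fin.val_zero]; omega)
      simp only [Fin.val_zero, mul_zero, zero_add] at h1
      have := hk 0; rw [h1]; omega)
    (by
      have h1 := hqo (Fin.last m) (by simp; omega)
      simp only [Fin.val_last] at h1
      have := hk (Fin.last m); rw [h1]; omega)
    (by
      rintro ⟨j, hj⟩ hq
      have : j % 2 = 1 := by
        by_contra h
        exact hq (by simp [q, h])
      simp only [Fin.mk_le_mk]
      omega)
  have hl : t' m = t (Fin.last m) := ht' (Fin.last m)
  have hz : t' 0 = t 0 := ht' 0
  have e1 : g (⟨1, by omega⟩ : Fin ((m + 1) * 2)).castSucc = t 0 - d := by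
    have := pairGrid_odd t' d 0
    rw [hz] at this; exact this
  have e2 : g (⟨1, by omega⟩ : Fin ((m + 1) * 2)).succ = t 0 := by
    have := pairGrid_even t' d 0
    rw [hz] at this; exact this
  have e3 : g (⟨2 * m + 1, by omega⟩ : Fin ((m + 1) * 2)).castSucc = t (Fin.last m) - d := by
    have := pairGrid_odd t' d m
    rw [hl] at this; exact this
  have e4 : g (⟨2 * m + 1, by omega⟩ : Fin ((m + 1) * 2)).succ = t (Fin.last m) := by
    have := pairGrid_even t' d m
    rw [hl] at this; exact this
  rw [e1, e2, e3, e4, hprod fun x y => x - y] at hB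
  simp_rw [fun ω => hprod fun x y => X x ω - X y ω, sub_sub_cancel, Finset.prod_pow_eq_pow_sum] at hB
  rw [← Real.exp_add, ← Real.exp_add]
  unfold increment
  constructor
  · refine le_trans (le_of_eq ?_) hB.1
    rw [mul_assoc]; ring_nf
  · refine le_trans hB.2 (le_of_eq ?_)
    rw [mul_assoc]; ring_nf

/-- The mixed moments of short increments, divided by the corresponding power of the length. -/
theorem tendsto_integral_prod_increment_pow_div (hX : IsExpProcess μ X lam b T) (hlam : 0 ≤ lam)
    (hb : 0 ≤ b) {m : ℕ} {t : Fin (m + 1) → ℝ} (h0 : 0 < t 0) (ht : StrictMono t)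
    (hT : t (Fin.last m) ≤ T) {k : Fin (m + 1) → ℕ} (hk : ∀ i, 1 ≤ k i) :
    Tendsto (fun d : ℝ => (∫ ω, ∏ i, increment X d (t i) ω ^ k i ∂μ) / d ^ (∑ i, k i))
      (𝓝[>] 0) (𝓝 (b * Real.exp (-lam * T) * Real.exp (-lam * (t (Fin.last m) - t 0)))) := by
  have hev : ∀ᶠ d in 𝓝[>] (0 : ℝ), 0 < d ∧ d < t 0 ∧ ∀ i : Fin m, d < t i.succ - t i.castSucc := by
    refine (eventually_mem_nhdsWithin.mono fun d hd => hd).and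
      (Filter.Eventually.and ?_ (Filter.eventually_all.mpr fun i => ?_))
    · exact nhdsWithin_le_nhds (eventually_lt_nhds h0)
    · exact nhdsWithin_le_nhds (eventually_lt_nhds (sub_pos.mpr (ht Fin.castSucc_lt_succ)))
  have hlim : ∀ a : ℝ, Tendsto (fun d : ℝ => b * Real.exp (-lam * T) *
      (Real.exp (-lam * (t (Fin.last m) - t 0)) * Real.exp (a * d))) (𝓝[>] 0)
      (𝓝 (b * Real.exp (-lam * T) * Real.exp (-lam * (t (Fin.last m) - t 0)))) := by
    intro a
    have : Continuous fun d : ℝ => b * Real.exp (-lam * T) *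
      (Real.exp (-lam * (t (Fin.last m) - t 0)) * Real.exp (a * d)) := by fun_prop
    simpa using (this.tendsto 0).mono_left nhdsWithin_le_nhds
  -- The bounds have the common limit because `exp (∓ lam * d)` tends to `1`.
  refine tendsto_of_tendsto_of_tendsto_of_le_of_le' (hlim (-lam)) (hlim lam) ?_ ?_
  · filter_upwards [hev] with d ⟨hd, hd0, hdt⟩
    rw [le_div_iff₀ (by positivity), neg_mul lam d]
    exact (hX.integral_prod_increment_pow_bounds hlam hb hT hk hd hd0 hdt).1
  · filter_upwards [hev] with d ⟨hd, hd0, hdt⟩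
    rw [div_le_iff₀ (by positivity)]
    exact (hX.integral_prod_increment_pow_bounds hlam hb hT hk hd hd0 hdt).2

end IsExpProcess

theorem isEquivalent_pow_mul_of_tendsto_div {f : ℝ → ℝ} {n : ℕ} {L : ℝ} (hL : L ≠ 0)
    (h : Tendsto (fun d => f d / d ^ n) (𝓝[>] 0) (𝓝 L)) :
    f ~[𝓝[>] 0] fun d => d ^ n * L := by
  refine isEquivalent_of_tendsto_one ?_
  have := h.div_const L
  rw [div_self hL] at this
  refine this.congr fun d => ?_
  rw [Pi.div_apply, div_div]

/-! ### Exact first and second moments -/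

namespace IsExpProcess

variable {Ω : Type*} [MeasurableSpace Ω] {μ : Measure Ω} {X : ℝ → Ω → ℝ} {lam b T : ℝ}

theorem integral_pow_eq (hX : IsExpProcess μ X lam b T) {u : ℝ} (hu : 0 < u) (huT : u ≤ T)
    {n : ℕ} (hn : n ≠ 0) : ∫ ω, X u ω ^ n ∂μ
      = n.factorial * (b * Real.exp (-lam * T) * ExpProcess.blockIntegral 0 u n lam lam) := by
  have ht : StrictMono ![0, u] := by
    rw [Fin.strictMono_iff_lt_succ]; intro i; fin_cases i; simpa using hu
  have h := hX.integral_prod_increments_pow (t := ![0, u]) rfl ht (by simpa using huT) ![n]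
  rw [ExpProcess.mgfCoeff_eq_prod ht (i₀ := 0) (i₁ := 0) (by simpa using hn) (by simpa using hn)
    (fun j _ => by simp [Subsingleton.elim j 0])] at h
  have hs : ExpProcess.supp ![n] = {0} := by
    ext j
    simp [ExpProcess.supp, Subsingleton.elim j 0, Nat.one_le_iff_ne_zero, hn]
  rw [hs] at h
  simp only [Finset.prod_singleton, Finset.univ_unique, Fin.default_eq_zero, Fin.succ_zero_eq_one,
    Fin.castSucc_zero, Matrix.cons_val_zero, Matrix.cons_val_one, if_true] at h
  rw [← h]
  refine integral_congr_ae ?_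
  filter_upwards [hX.zero] with ω hω
  rw [hω, sub_zero]

theorem integral_eq (hX : IsExpProcess μ X lam b T) {u : ℝ} (hu : u ∈ Set.Icc 0 T) :
    ∫ ω, X u ω ∂μ = b * Real.exp (-lam * T) * u := by
  rcases hu.1.eq_or_lt with rfl | h0
  · rw [integral_congr_ae hX.zero]; simp
  · have := hX.integral_pow_eq h0 hu.2 one_ne_zero
    simpa [ExpProcess.blockIntegral_one_same] using this

/-- Uses the grid `0, u, v` with multiplicity one on both intervals: the first carries the left
weight, the second the right weight. -/
theorem integral_mul_sub_eq (hX : IsExpProcess μ X lam b T) (hlam : lam ≠ 0) {u v : ℝ} (hu : 0 < u)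
    (huv : u < v) (hvT : v ≤ T) : ∫ ω, X u ω * (X v ω - X u ω) ∂μ
      = b * Real.exp (-lam * T) / lam ^ 2 * (1 - Real.exp (-lam * (v - u)) - Real.exp (-lam * u)
        + Real.exp (-lam * v)) := by
  have ht : StrictMono ![0, u, v] := by
    rw [Fin.strictMono_iff_lt_succ]; intro i; fin_cases i
    · simpa using hu
    · simpa using huv
  have h := hX.integral_prod_increments_pow (t := ![0, u, v]) rfl ht (by simpa using hvT) ![1, 1]
  have hs : ExpProcess.supp ![1, 1] = Finset.univ := by
    ext j
    fin_cases j <;> simp [ExpProcess.supp]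
  rw [ExpProcess.mgfCoeff_eq_prod ht (i₀ := 0) (i₁ := 1) (by simp) (by simp)
    (fun j _ => by fin_cases j <;> simp), hs, Fin.prod_univ_two, Fin.prod_univ_two] at h
  have h' : ∫ ω, X u ω * (X v ω - X u ω) ∂μ = b * Real.exp (-lam * T)
      * (ExpProcess.blockIntegral 0 u 1 lam 0 * ExpProcess.blockIntegral u v 1 0 lam) := by
    simp [Fin.prod_univ_two] at h
    rw [← neg_mul] at h
    rw [← h]
    refine integral_congr_ae ?_
    filter_upwards [hX.zero] with ω hω
    rw [hω, sub_zero]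
  have e1 : Real.exp (-lam * (v - u)) = Real.exp (lam * u) * Real.exp (-lam * v) := by
    rw [← Real.exp_add]; ring_nf
  have e2 : Real.exp (lam * u) * Real.exp (-lam * u) = 1 := by rw [← Real.exp_add]; simp
  rw [h', ExpProcess.blockIntegral_one_left _ _ hlam, ExpProcess.blockIntegral_one_right _ _ hlam,
    e1, mul_zero, Real.exp_zero]
  generalize Real.exp (-lam * u) = A at *
  generalize Real.exp (-lam * v) = B at *
  generalize Real.exp (lam * u) = C at *
  field_simp
  linear_combination b * e2

/-- The second mixed moments of an exponential process. -/
theorem integral_mul_eq [IsFiniteMeasure μ] (hX : IsExpProcess μ X lam b T) (hlam : lam ≠ 0)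
    {u v : ℝ} (hu : 0 ≤ u) (huv : u ≤ v) (hvT : v ≤ T) : ∫ ω, X u ω * X v ω ∂μ
      = b * Real.exp (-lam * T) / lam ^ 2 * (Real.exp (-lam * u) + Real.exp (-lam * v)
        - Real.exp (-lam * (v - u)) - 1 + 2 * lam * u) := by
  rcases hu.eq_or_lt with rfl | hu
  · have : (fun ω => X 0 ω * X v ω) =ᵐ[μ] fun _ => 0 := by
      filter_upwards [hX.zero] with ω hω
      rw [hω, zero_mul]
    rw [integral_congr_ae this]; simp
  have hsq : ∫ ω, X u ω * X u ω ∂μ = b * Real.exp (-lam * T) / lam ^ 2 *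
      (2 * Real.exp (-lam * u) - 2 + 2 * lam * u) := by
    have := hX.integral_pow_eq hu (huv.trans hvT) two_ne_zero
    simp_rw [pow_two (X u _)] at this
    rw [this, ExpProcess.blockIntegral_two_same _ _ hlam, sub_zero, Nat.factorial_two]
    push_cast
    field_simp
    ring
  rcases huv.eq_or_lt with rfl | huv
  · rw [hsq, sub_self, mul_zero, Real.exp_zero]; ring
  · have hmu : MemLp (X u) 2 μ := by exact_mod_cast hX.memLp ⟨hu.le, huv.le.trans hvT⟩ 2
    have hmv : MemLp (X v) 2 μ := by exact_mod_cast hX.memLp ⟨hu.le.trans huv.le, hvT⟩ 2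
    have i1 : Integrable (fun ω => X u ω * X u ω) μ := hmu.integrable_mul hmu
    have i2 : Integrable (fun ω => X u ω * (X v ω - X u ω)) μ := hmu.integrable_mul (hmv.sub hmu)
    have : (fun ω => X u ω * X v ω) = fun ω => X u ω * X u ω + X u ω * (X v ω - X u ω) := by
      ext ω; ring
    rw [this, integral_add i1 i2, hsq,
      hX.integral_mul_sub_eq hlam hu huv hvT]
    ring

theorem memLp_two [IsFiniteMeasure μ] (hX : IsExpProcess μ X lam b T) {t : ℝ}
    (ht : t ∈ Set.Icc 0 T) : MemLp (X t) 2 μ := by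
  exact_mod_cast hX.memLp ht 2

theorem memLp_two_increment [IsFiniteMeasure μ] (hX : IsExpProcess μ X lam b T) {d t : ℝ}
    (hd : 0 ≤ d) (hdt : d ≤ t) (ht : t ≤ T) : MemLp (increment X d t) 2 μ := by
  exact_mod_cast hX.memLp_increment hd hdt ht 2

theorem integral_increment [IsFiniteMeasure μ] (hX : IsExpProcess μ X lam b T) {d t : ℝ}
    (hd : 0 ≤ d) (hdt : d ≤ t) (ht : t ≤ T) :
    ∫ ω, increment X d t ω ∂μ = b * Real.exp (-lam * T) * d := by
  have h1 : t ∈ Set.Icc 0 T := ⟨hd.trans hdt, ht⟩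
  have h2 : t - d ∈ Set.Icc 0 T := ⟨by linarith, by linarith⟩
  unfold increment
  rw [integral_sub ((hX.memLp_two h1).integrable one_le_two)
    ((hX.memLp_two h2).integrable one_le_two), hX.integral_eq h1, hX.integral_eq h2]
  ring

theorem integral_increment_mul [IsFiniteMeasure μ] (hX : IsExpProcess μ X lam b T) {d t s : ℝ}
    (hd : 0 ≤ d) (hdt : d ≤ t) (hds : d ≤ s) (ht : t ≤ T) (hs : s ≤ T) :
    ∫ ω, increment X d t ω * increment X d s ω ∂μ
      = ∫ ω, X t ω * X s ω ∂μ - ∫ ω, X t ω * X (s - d) ω ∂μ - ∫ ω, X (t - d) ω * X s ω ∂μ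
        + ∫ ω, X (t - d) ω * X (s - d) ω ∂μ := by
  have h1 := hX.memLp_two (t := t) ⟨hd.trans hdt, ht⟩
  have h2 := hX.memLp_two (t := t - d) ⟨by linarith, by linarith⟩
  have h3 := hX.memLp_two (t := s) ⟨hd.trans hds, hs⟩
  have h4 := hX.memLp_two (t := s - d) ⟨by linarith, by linarith⟩
  have i1 : Integrable (fun ω => X t ω * X s ω) μ := h1.integrable_mul h3
  have i2 : Integrable (fun ω => X t ω * X (s - d) ω) μ := h1.integrable_mul h4
  have i3 : Integrable (fun ω => X (t - d) ω * X s ω) μ := h2.integrable_mul h3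
  have i4 : Integrable (fun ω => X (t - d) ω * X (s - d) ω) μ := h2.integrable_mul h4
  have i12 : Integrable (fun ω => X t ω * X s ω - X t ω * X (s - d) ω) μ := i1.sub i2
  have i123 : Integrable
      (fun ω => X t ω * X s ω - X t ω * X (s - d) ω - X (t - d) ω * X s ω) μ := i12.sub i3
  have e : (fun ω => increment X d t ω * increment X d s ω) = fun ω =>
      X t ω * X s ω - X t ω * X (s - d) ω - X (t - d) ω * X s ω + X (t - d) ω * X (s - d) ω := by
    ext ω; unfold increment; ring
  rw [e, integral_add i123 i4, integral_sub i12 i3, integral_sub i1 i2]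

/-- The second mixed moment of two increments over disjoint intervals. -/
theorem integral_increment_mul_of_disjoint [IsFiniteMeasure μ] (hX : IsExpProcess μ X lam b T)
    (hlam : lam ≠ 0) {d t s : ℝ} (hd : 0 ≤ d) (hdt : d ≤ t) (hts : d ≤ s - t) (hs : s ≤ T) :
    ∫ ω, increment X d t ω * increment X d s ω ∂μ
      = b * Real.exp (-lam * T) / lam ^ 2 * Real.exp (-lam * (s - t))
        * (Real.exp (lam * d) - 2 + Real.exp (-lam * d)) := by
  rw [hX.integral_increment_mul hd hdt (by linarith) (by linarith) hs,
    hX.integral_mul_eq hlam (by linarith) (by linarith) hs,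
    hX.integral_mul_eq hlam (by linarith) (by linarith) (by linarith),
    hX.integral_mul_eq hlam (by linarith) (by linarith) hs,
    hX.integral_mul_eq hlam (by linarith) (by linarith) (by linarith)]
  have e1 : Real.exp (-lam * (s - d - t)) = Real.exp (-lam * (s - t)) * Real.exp (lam * d) := by
    rw [← Real.exp_add]; ring_nf
  have e2 : Real.exp (-lam * (s - (t - d))) = Real.exp (-lam * (s - t)) * Real.exp (-lam * d) := by
    rw [← Real.exp_add]; ring_nf
  rw [e1, e2, show s - d - (t - d) = s - t by ring]
  ring

/-- The second mixed moment of two increments over overlapping intervals. -/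
theorem integral_increment_mul_of_overlap [IsFiniteMeasure μ] (hX : IsExpProcess μ X lam b T)
    (hlam : lam ≠ 0) {d t s : ℝ} (hdt : d ≤ t) (hts : t ≤ s) (hsd : s - t ≤ d)
    (hs : s ≤ T) :
    ∫ ω, increment X d t ω * increment X d s ω ∂μ
      = b * Real.exp (-lam * T) / lam ^ 2 * (Real.exp (-lam * d) *
        (Real.exp (lam * (s - t)) + Real.exp (-lam * (s - t))) - 2 * Real.exp (-lam * (s - t))
        + 2 * lam * (d - (s - t))) := by
  -- Overlap means `s - d ≤ t`, so this product must be reordered before `integral_mul_eq` applies.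
  have hcomm : ∫ ω, X t ω * X (s - d) ω ∂μ = ∫ ω, X (s - d) ω * X t ω ∂μ := by
    simp_rw [mul_comm]
  rw [hX.integral_increment_mul (by linarith) hdt (by linarith) (by linarith) hs, hcomm,
    hX.integral_mul_eq hlam (u := t) (v := s) (by linarith) (by linarith) hs,
    hX.integral_mul_eq hlam (u := s - d) (v := t) (by linarith) (by linarith) (by linarith),
    hX.integral_mul_eq hlam (u := t - d) (v := s) (by linarith) (by linarith) hs,
    hX.integral_mul_eq hlam (u := t - d) (v := s - d) (by linarith) (by linarith) (by linarith)]
  have e1 : Real.exp (-lam * (t - (s - d))) = Real.exp (-lam * d) * Real.exp (lam * (s - t)) := by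
    rw [← Real.exp_add]; ring_nf
  have e2 : Real.exp (-lam * (s - (t - d))) = Real.exp (-lam * d) * Real.exp (-lam * (s - t)) := by
    rw [← Real.exp_add]; ring_nf
  rw [e1, e2, show s - d - (t - d) = s - t by ring]
  ring

theorem covariance_increment [IsProbabilityMeasure μ] (hX : IsExpProcess μ X lam b T) {d t s : ℝ}
    (hd : 0 ≤ d) (hdt : d ≤ t) (hds : d ≤ s) (ht : t ≤ T) (hs : s ≤ T) :
    cov[increment X d t, increment X d s; μ]
      = ∫ ω, increment X d t ω * increment X d s ω ∂μ - (b * Real.exp (-lam * T) * d) ^ 2 := by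
  rw [covariance_eq_sub (hX.memLp_two_increment hd hdt ht) (hX.memLp_two_increment hd hds hs),
    hX.integral_increment hd hdt ht, hX.integral_increment hd hds hs]
  simp only [Pi.mul_apply]
  ring

theorem variance_increment [IsProbabilityMeasure μ] (hX : IsExpProcess μ X lam b T) {d t : ℝ}
    (hd : 0 ≤ d) (hdt : d ≤ t) (ht : t ≤ T) :
    Var[increment X d t; μ]
      = ∫ ω, increment X d t ω * increment X d t ω ∂μ - (b * Real.exp (-lam * T) * d) ^ 2 := by
  rw [← covariance_self (hX.memLp_two_increment hd hdt ht).aemeasurable,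
    hX.covariance_increment hd hdt hdt ht ht]

theorem variance_increment_eq [IsProbabilityMeasure μ] (hX : IsExpProcess μ X lam b T)
    (hlam : lam ≠ 0) {d t : ℝ} (hd : 0 ≤ d) (hdt : d ≤ t) (ht : t ≤ T) :
    Var[increment X d t; μ] = b * Real.exp (-lam * T) / lam ^ 2 *
      (2 * (Real.exp (-lam * d) - 1 + lam * d)) - (b * Real.exp (-lam * T) * d) ^ 2 := by
  rw [hX.variance_increment hd hdt ht,
    hX.integral_increment_mul_of_overlap hlam hdt le_rfl (by linarith) ht]
  simp only [sub_self, mul_zero, Real.exp_zero, sub_zero]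
  ring

end IsExpProcess

/-! ### Positivity of the variance -/

/-- Multiplied by `exp u`, the difference of the two sides is `2 + 2 * (u - 1) * exp u - u ^ 2`,
which vanishes at `0` and has derivative `2 * u * (exp u - 1)`. -/
theorem sq_mul_exp_neg_lt {u : ℝ} (hu : 0 < u) :
    u ^ 2 * Real.exp (-u) < 2 * (Real.exp (-u) - 1 + u) := by
  have hmono : StrictMonoOn (fun x : ℝ => 2 + 2 * (x - 1) * Real.exp x - x ^ 2) (Set.Ici 0) := by
    refine strictMonoOn_of_hasDerivWithinAt_pos (f' := fun x => 2 * x * (Real.exp x - 1))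
      (convex_Ici 0) (by fun_prop) (fun x _ => HasDerivAt.hasDerivWithinAt ?_) fun x hx => ?_
    · have := ((((hasDerivAt_id x).sub_const 1).const_mul 2).mul (Real.hasDerivAt_exp x)).const_add 2
      refine (this.sub (hasDerivAt_pow 2 x)).congr_deriv ?_
      simp only [id]
      push_cast
      ring
    · rw [interior_Ici, Set.mem_Ioi] at hx
      have := Real.one_lt_exp_iff.mpr hx
      have : 0 < Real.exp x - 1 := by linarith
      positivity
  have h := hmono (Set.mem_Ici.mpr le_rfl) hu.le hu
  simp only [zero_sub, Real.exp_zero] at h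
  have h1 : Real.exp u * Real.exp (-u) = 1 := by rw [← Real.exp_add]; simp
  have h2 := Real.exp_pos (-u)
  nlinarith [mul_pos (show 0 < 2 + 2 * (u - 1) * Real.exp u - u ^ 2 by linarith) h2]

theorem IsExpProcess.variance_increment_pos {Ω : Type*} [MeasurableSpace Ω] {μ : Measure Ω}
    [IsProbabilityMeasure μ] {X : ℝ → Ω → ℝ} {lam b T : ℝ} (hX : IsExpProcess μ X lam b T)
    (hlam : 0 < lam) (hb0 : 0 < b) (hb1 : b ≤ 1) {d t : ℝ} (hd : 0 < d) (hdt : d ≤ t)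
    (ht : t ≤ T) : 0 < Var[increment X d t; μ] := by
  rw [hX.variance_increment_eq hlam.ne' hd.le hdt ht]
  have h1 := sq_mul_exp_neg_lt (mul_pos hlam hd)
  -- Here `b ≤ 1` and `d ≤ t ≤ T` enter; the squared mean is thereby controlled by the elementary
  -- inequality with `u = lam * d`.
  have h2 : b * Real.exp (-lam * T) ≤ Real.exp (-(lam * d)) := by
    have : Real.exp (-lam * T) ≤ Real.exp (-(lam * d)) := Real.exp_le_exp.mpr (by nlinarith)
    nlinarith [Real.exp_pos (-lam * T)]
  have hc : 0 < b * Real.exp (-lam * T) := by positivity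
  rw [neg_mul lam d]
  generalize b * Real.exp (-lam * T) = c at *
  have h3 : (lam * d) ^ 2 * c < 2 * (Real.exp (-(lam * d)) - 1 + lam * d) :=
    (mul_le_mul_of_nonneg_left h2 (by positivity)).trans_lt h1
  have h4 : c / lam ^ 2 * ((lam * d) ^ 2 * c) = (c * d) ^ 2 := by field_simp
  rw [← h4, ← mul_sub]
  exact mul_pos (by positivity) (sub_pos.mpr h3)

/-! ### Asymptotics of covariances and correlations -/

/-- The second-order Taylor limit of the exponential function at zero, along a linear
substitution. -/
theorem tendsto_exp_sub_div_sq (a : ℝ) :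
    Tendsto (fun h : ℝ => (Real.exp (a * h) - 1 - a * h) / h ^ 2) (𝓝[>] 0) (𝓝 (a ^ 2 / 2)) := by
  have h1 := Real.exp_sub_sum_range_succ_isLittleO_pow 2
  have h2 : Tendsto (fun h : ℝ => a * h) (𝓝[>] 0) (𝓝 0) := by
    have : Continuous fun h : ℝ => a * h := by fun_prop
    simpa using (this.tendsto 0).mono_left nhdsWithin_le_nhds
  have hO : ((fun x : ℝ => x ^ 2) ∘ fun h : ℝ => a * h) =O[𝓝[>] 0] fun h : ℝ => h ^ 2 := by
    refine IsBigO.of_bound (a ^ 2) (Eventually.of_forall fun h => le_of_eq ?_)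
    simp [mul_pow]
  have h4 := ((h1.comp_tendsto h2).trans_isBigO hO).tendsto_div_nhds_zero.add_const (a ^ 2 / 2)
  rw [zero_add] at h4
  refine h4.congr' ?_
  filter_upwards [self_mem_nhdsWithin] with h hh
  have : h ≠ 0 := (Set.mem_Ioi.mp hh).ne'
  simp [Finset.sum_range_succ]
  field_simp
  ring

namespace IsExpProcess

variable {Ω : Type*} [MeasurableSpace Ω] {μ : Measure Ω} {X : ℝ → Ω → ℝ} {lam b T : ℝ}

theorem tendsto_integral_increment_mul_div (hX : IsExpProcess μ X lam b T) (hlam : 0 ≤ lam)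
    (hb : 0 ≤ b) {t s : ℝ} (ht : 0 < t) (hts : t < s) (hs : s ≤ T) :
    Tendsto (fun d : ℝ => (∫ ω, increment X d t ω * increment X d s ω ∂μ) / d ^ 2) (𝓝[>] 0)
      (𝓝 (b * Real.exp (-lam * T) * Real.exp (-lam * (s - t)))) := by
  have h := hX.tendsto_integral_prod_increment_pow_div hlam hb (t := ![t, s]) (k := ![1, 1])
    (by simpa using ht)
    (by rw [Fin.strictMono_iff_lt_succ]; intro i; fin_cases i; simpa using hts)
    (by simpa using hs) (fun i => by fin_cases i <;> simp)
  simpa [Fin.prod_univ_two, Fin.sum_univ_two] using h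

theorem tendsto_integral_increment_pow_div (hX : IsExpProcess μ X lam b T) (hlam : 0 ≤ lam)
    (hb : 0 ≤ b) {t : ℝ} (ht : 0 < t) (hT : t ≤ T) {k : ℕ} (hk : 1 ≤ k) :
    Tendsto (fun d : ℝ => (∫ ω, increment X d t ω ^ k ∂μ) / d ^ k) (𝓝[>] 0)
      (𝓝 (b * Real.exp (-lam * T))) := by
  have h := hX.tendsto_integral_prod_increment_pow_div hlam hb (t := fun _ : Fin 1 => t)
    (k := fun _ => k) ht (by rw [Fin.strictMono_iff_lt_succ]; exact fun i => i.elim0) hT (fun _ => hk)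
  simpa using h

theorem tendsto_covariance_increment_div [IsProbabilityMeasure μ] (hX : IsExpProcess μ X lam b T)
    (hlam : 0 ≤ lam) (hb : 0 ≤ b) {t s : ℝ} (ht : 0 < t) (hts : t < s) (hs : s ≤ T) :
    Tendsto (fun d : ℝ => cov[increment X d t, increment X d s; μ] / d ^ 2) (𝓝[>] 0)
      (𝓝 (b * Real.exp (-lam * T) * (Real.exp (-lam * (s - t)) - b * Real.exp (-lam * T)))) := by
  have h := (hX.tendsto_integral_increment_mul_div hlam hb ht hts hs).sub_const
    ((b * Real.exp (-lam * T)) ^ 2)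
  rw [show b * Real.exp (-lam * T) * Real.exp (-lam * (s - t)) - (b * Real.exp (-lam * T)) ^ 2
    = b * Real.exp (-lam * T) * (Real.exp (-lam * (s - t)) - b * Real.exp (-lam * T)) by ring] at h
  refine h.congr' ?_
  filter_upwards [self_mem_nhdsWithin, nhdsWithin_le_nhds (eventually_lt_nhds ht)] with d hd hdt
  rw [Set.mem_Ioi] at hd
  have hdt : d < t := hdt
  rw [hX.covariance_increment hd.le hdt.le (by linarith) (by linarith) hs]
  field_simp

theorem tendsto_variance_increment_div [IsProbabilityMeasure μ] (hX : IsExpProcess μ X lam b T)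
    (hlam : 0 ≤ lam) (hb : 0 ≤ b) {t : ℝ} (ht : 0 < t) (hT : t ≤ T) :
    Tendsto (fun d : ℝ => Var[increment X d t; μ] / d ^ 2) (𝓝[>] 0)
      (𝓝 (b * Real.exp (-lam * T) * (1 - b * Real.exp (-lam * T)))) := by
  have h := (hX.tendsto_integral_increment_pow_div hlam hb ht hT one_le_two).sub_const
    ((b * Real.exp (-lam * T)) ^ 2)
  rw [show b * Real.exp (-lam * T) - (b * Real.exp (-lam * T)) ^ 2
    = b * Real.exp (-lam * T) * (1 - b * Real.exp (-lam * T)) by ring] at h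
  refine h.congr' ?_
  filter_upwards [self_mem_nhdsWithin, nhdsWithin_le_nhds (eventually_lt_nhds ht)] with d hd hdt
  rw [Set.mem_Ioi] at hd
  have hdt : d < t := hdt
  rw [hX.variance_increment hd.le hdt.le hT]
  simp_rw [← pow_two (increment X d t _)]
  field_simp

/-- Covariance and variances are all of order `d ^ 2`, and the variances at `t` and `s` have the
same normalized limit, so the square roots recombine. The strict bound on `b * exp (-lam * T)` keeps
the denominator nonzero. -/
theorem tendsto_corr_increment [IsProbabilityMeasure μ] (hX : IsExpProcess μ X lam b T)
    (hlam : 0 ≤ lam) (hb : 0 < b) (hc1 : b * Real.exp (-lam * T) < 1) {t s : ℝ} (ht : 0 < t)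
    (hts : t < s) (hs : s ≤ T) :
    Tendsto (fun d : ℝ => corr (increment X d t) (increment X d s) μ) (𝓝[>] 0)
      (𝓝 ((Real.exp (-lam * (s - t)) - b * Real.exp (-lam * T))
        / (1 - b * Real.exp (-lam * T)))) := by
  have hc := hX.tendsto_covariance_increment_div hlam hb.le ht hts hs
  have hv := fun {r : ℝ} (hr : 0 < r) (hrT : r ≤ T) =>
    (hX.tendsto_variance_increment_div hlam hb.le hr hrT).sqrt
  have hpos : 0 < b * Real.exp (-lam * T) := by positivity
  have hpos1 : 0 < 1 - b * Real.exp (-lam * T) := by linarith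
  have hne : √(b * Real.exp (-lam * T) * (1 - b * Real.exp (-lam * T))) ≠ 0 :=
    (Real.sqrt_pos.mpr (mul_pos hpos hpos1)).ne'
  have h := hc.div ((hv ht (hts.le.trans hs)).mul (hv (ht.trans hts) hs)) (mul_ne_zero hne hne)
  rw [Real.mul_self_sqrt (mul_pos hpos hpos1).le, mul_div_mul_left _ _ hpos.ne'] at h
  refine h.congr' ?_
  filter_upwards [self_mem_nhdsWithin] with d hd
  have hd : 0 < d := hd
  simp only [Pi.div_apply, Real.sqrt_div' _ (sq_nonneg d), Real.sqrt_sq hd.le, corr]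
  field_simp

/-- The correlation coefficient of two increments over overlapping intervals. -/
theorem one_sub_corr_increment [IsProbabilityMeasure μ] (hX : IsExpProcess μ X lam b T)
    (hlam : 0 < lam) (hb0 : 0 < b) (hb1 : b ≤ 1) {d t s : ℝ} (hd : 0 < d) (hdt : d ≤ t)
    (hts : t ≤ s) (hsd : s - t ≤ d) (hs : s ≤ T) :
    1 - corr (increment X d t) (increment X d s) μ
      = b * Real.exp (-lam * T) / lam ^ 2 / Var[increment X d t; μ] *
        (2 * (Real.exp (-lam * (s - t)) - 1 - -lam * (s - t)) - Real.exp (-lam * d) *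
          ((Real.exp (lam * (s - t)) - 1 - lam * (s - t))
            + (Real.exp (-lam * (s - t)) - 1 - -lam * (s - t)))) := by
  have hV := hX.variance_increment_pos hlam hb0 hb1 hd hdt (hts.trans hs)
  have hVs : Var[increment X d s; μ] = Var[increment X d t; μ] := by
    rw [hX.variance_increment_eq hlam.ne' hd.le hdt (hts.trans hs),
      hX.variance_increment_eq hlam.ne' hd.le (hdt.trans hts) hs]
  rw [corr, hVs, Real.mul_self_sqrt hV.le,
    hX.covariance_increment hd.le hdt (hdt.trans hts) (hts.trans hs) hs,
    hX.integral_increment_mul_of_overlap hlam.ne' hdt hts hsd hs, one_sub_div hV.ne',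
    div_mul_eq_mul_div]
  -- The squared means cancel in variance minus covariance; what remains regroups into Taylor
  -- remainders in `s - t`.
  rw [hX.variance_increment_eq hlam.ne' hd.le hdt (hts.trans hs)]
  ring

end IsExpProcess

theorem tendsto_overlap_defect_div_sq (lam d : ℝ) :
    Tendsto (fun h : ℝ => (2 * (Real.exp (-lam * h) - 1 - -lam * h) - Real.exp (-lam * d) *
      ((Real.exp (lam * h) - 1 - lam * h) + (Real.exp (-lam * h) - 1 - -lam * h))) / h ^ 2)
      (𝓝[>] 0) (𝓝 (lam ^ 2 * (1 - Real.exp (-lam * d)))) := by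
  have h1 := tendsto_exp_sub_div_sq lam
  have h2 := tendsto_exp_sub_div_sq (-lam)
  have h := (h2.const_mul 2).sub ((h1.add h2).const_mul (Real.exp (-lam * d)))
  rw [show 2 * ((-lam) ^ 2 / 2) - Real.exp (-lam * d) * (lam ^ 2 / 2 + (-lam) ^ 2 / 2)
    = lam ^ 2 * (1 - Real.exp (-lam * d)) by ring] at h
  refine h.congr fun x => ?_
  ring

/-- The quadratic law is the substantive part. The first equivalence follows because both sides tend
to `1`, whatever the linear coefficient. -/
theorem IsExpProcess.corr_increment_isEquivalent_of_overlap {Ω : Type*} [MeasurableSpace Ω]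
    {μ : Measure Ω} [IsProbabilityMeasure μ] {X : ℝ → Ω → ℝ} {lam b T : ℝ}
    (hX : IsExpProcess μ X lam b T) (hlam : 0 < lam) (hb0 : 0 < b) (hb1 : b ≤ 1) {d : ℝ}
    (hd : 0 < d) :
    (fun p : ℝ × ℝ => corr (increment X d p.1) (increment X d p.2) μ)
        ~[comap (fun p : ℝ × ℝ => p.2 - p.1) (𝓝[>] 0) ⊓ 𝓟 {p | d ≤ p.1 ∧ p.2 ≤ T}]
      (fun p : ℝ × ℝ =>
        1 - 2 * b * Real.exp (-lam * T) / (lam ^ 2 * Var[increment X d p.1; μ])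
          * (p.2 - p.1)) ∧
    (fun p : ℝ × ℝ => 1 - corr (increment X d p.1) (increment X d p.2) μ)
        ~[comap (fun p : ℝ × ℝ => p.2 - p.1) (𝓝[>] 0) ⊓ 𝓟 {p | d ≤ p.1 ∧ p.2 ≤ T}]
      (fun p : ℝ × ℝ =>
        b * Real.exp (-lam * T) * (1 - Real.exp (-lam * d)) / Var[increment X d p.1; μ]
          * (p.2 - p.1) ^ 2) := by
  set l := comap (fun p : ℝ × ℝ => p.2 - p.1) (𝓝[>] 0) ⊓ 𝓟 {p | d ≤ p.1 ∧ p.2 ≤ T}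
  have hlim : Tendsto (fun p : ℝ × ℝ => p.2 - p.1) l (𝓝[>] 0) := tendsto_comap.mono_left inf_le_left
  have hev : ∀ᶠ p : ℝ × ℝ in l, (0 < p.2 - p.1 ∧ p.2 - p.1 < d) ∧ d ≤ p.1 ∧ p.2 ≤ T := by
    have hsmall : ∀ᶠ h : ℝ in 𝓝[>] 0, 0 < h ∧ h < d :=
      (eventually_mem_nhdsWithin.mono fun x hx => hx).and
        (nhdsWithin_le_nhds (eventually_lt_nhds hd))
    exact (hlim.eventually hsmall).and (inf_le_right (a := comap _ _) (mem_principal_self _))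
  -- If `d > T`, no admissible pair exists and the filter is trivial.
  by_cases hdT : d ≤ T
  swap
  · have hbot : ∀ᶠ p : ℝ × ℝ in l, False := by
      filter_upwards [hev] with p hp
      exact hdT (by linarith [hp.1.1, hp.2.1, hp.2.2])
    exact ⟨EventuallyEq.isEquivalent (hbot.mono fun p hp => hp.elim),
      EventuallyEq.isEquivalent (hbot.mono fun p hp => hp.elim)⟩
  have hVpos := hX.variance_increment_pos hlam hb0 hb1 hd le_rfl hdT
  -- The variance is the same at every admissible time; `t = d` serves as reference.
  set V := Var[increment X d d; μ]
  have hV : ∀ᶠ p : ℝ × ℝ in l, Var[increment X d p.1; μ] = V := by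
    filter_upwards [hev] with p ⟨⟨h1, h2⟩, h3, h4⟩
    rw [hX.variance_increment_eq hlam.ne' hd.le h3 (by linarith)]
    exact (hX.variance_increment_eq hlam.ne' hd.le le_rfl hdT).symm
  have hexp : 0 < 1 - Real.exp (-lam * d) := by
    have : Real.exp (-lam * d) < 1 := by
      rw [Real.exp_lt_one_iff, neg_mul]; exact neg_neg_of_pos (mul_pos hlam hd)
    linarith
  have hquad : Tendsto (fun p : ℝ × ℝ =>
      (1 - corr (increment X d p.1) (increment X d p.2) μ) / (p.2 - p.1) ^ 2) l
      (𝓝 (b * Real.exp (-lam * T) * (1 - Real.exp (-lam * d)) / V)) := by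
    have h := ((tendsto_overlap_defect_div_sq lam d).comp hlim).const_mul
      (b * Real.exp (-lam * T) / lam ^ 2 / V)
    rw [show b * Real.exp (-lam * T) / lam ^ 2 / V * (lam ^ 2 * (1 - Real.exp (-lam * d)))
      = b * Real.exp (-lam * T) * (1 - Real.exp (-lam * d)) / V by field_simp] at h
    refine h.congr' ?_
    filter_upwards [hev, hV] with p ⟨⟨h1, h2⟩, h3, h4⟩ hVp
    rw [hX.one_sub_corr_increment hlam hb0 hb1 hd h3 (by linarith) h2.le h4, hVp]
    exact (mul_div_assoc _ _ _).symm
  have hlim0 : Tendsto (fun p : ℝ × ℝ => p.2 - p.1) l (𝓝 0) := hlim.mono_right nhdsWithin_le_nhds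
  constructor
  · have h1 : Tendsto (fun p : ℝ × ℝ => corr (increment X d p.1) (increment X d p.2) μ) l
        (𝓝 1) := by
      have h := (hquad.mul (hlim0.pow 2)).const_sub 1
      rw [zero_pow two_ne_zero, mul_zero, sub_zero] at h
      refine h.congr' ?_
      filter_upwards [hev] with p hp
      have := hp.1.1.ne'
      rw [div_mul_cancel₀ _ (pow_ne_zero 2 this), sub_sub_cancel]
    have h2 : Tendsto (fun p : ℝ × ℝ =>
        1 - 2 * b * Real.exp (-lam * T) / (lam ^ 2 * Var[increment X d p.1; μ]) * (p.2 - p.1)) l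
        (𝓝 1) := by
      have h := (hlim0.const_mul (2 * b * Real.exp (-lam * T) / (lam ^ 2 * V))).const_sub 1
      rw [mul_zero, sub_zero] at h
      refine h.congr' ?_
      filter_upwards [hV] with p hp
      rw [hp]
    exact ((isEquivalent_const_iff_tendsto one_ne_zero).mpr h1).trans
      ((isEquivalent_const_iff_tendsto one_ne_zero).mpr h2).symm
  · have hL : b * Real.exp (-lam * T) * (1 - Real.exp (-lam * d)) / V ≠ 0 := by positivity
    refine isEquivalent_of_tendsto_one ?_
    have h := hquad.div_const (b * Real.exp (-lam * T) * (1 - Real.exp (-lam * d)) / V)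
    rw [div_self hL] at h
    refine h.congr' ?_
    filter_upwards [hV] with p hp
    rw [Pi.div_apply, hp, div_div, mul_comm ((p.2 - p.1) ^ 2)]

/-- Numerator and denominator carry the same power of `d`. Each of the `m + 1` single moments
contributes one factor `b * exp (-lam * T)`, and the numerator has only one, which leaves the
exponent `m`. -/
theorem IsExpProcess.tendsto_integral_prod_increment_pow_ratio {Ω : Type*} [MeasurableSpace Ω]
    {μ : Measure Ω} {X : ℝ → Ω → ℝ} {lam b T : ℝ} (hX : IsExpProcess μ X lam b T)
    (hlam : 0 ≤ lam) (hb : 0 < b) {m : ℕ} {t : Fin (m + 1) → ℝ} (h0 : 0 < t 0)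
    (ht : StrictMono t) (hT : t (Fin.last m) ≤ T) {k : Fin (m + 1) → ℕ} (hk : ∀ i, 1 ≤ k i) :
    Tendsto
      (fun d : ℝ => (∫ ω, ∏ i, increment X d (t i) ω ^ k i ∂μ)
          / ∏ i, ∫ ω, increment X d (t i) ω ^ k i ∂μ)
      (𝓝[>] 0)
      (𝓝 ((1 / (b * Real.exp (-lam * T))) ^ m
          * Real.exp (-lam * (t (Fin.last m) - t 0)))) := by
  have hc : 0 < b * Real.exp (-lam * T) := by positivity
  have hnum := hX.tendsto_integral_prod_increment_pow_div hlam hb.le h0 ht hT hk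
  have hden := tendsto_finsetProd Finset.univ fun i _ =>
    hX.tendsto_integral_increment_pow_div hlam hb.le (h0.trans_le (ht.monotone (Fin.zero_le i)))
      ((ht.monotone (Fin.le_last i)).trans hT) (hk i)
  rw [Finset.prod_const, Finset.card_univ, Fintype.card_fin] at hden
  have h := hnum.div hden (pow_ne_zero _ hc.ne')
  generalize b * Real.exp (-lam * T) = c at *
  rw [show c * Real.exp (-lam * (t (Fin.last m) - t 0)) / c ^ (m + 1)
    = (1 / c) ^ m * Real.exp (-lam * (t (Fin.last m) - t 0)) by
      rw [pow_succ, one_div, inv_pow]; field_simp] at h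
  refine h.congr' ?_
  filter_upwards [self_mem_nhdsWithin] with d hd
  have hd : 0 < d := hd
  rw [Pi.div_apply, Finset.prod_div_distrib, Finset.prod_pow_eq_pow_sum,
    div_div_div_cancel_right₀ (by positivity)]

/-! ### The main theorem -/

theorem proposition3p8 {Ω : Type*} [MeasurableSpace Ω] (μ : Measure Ω) [IsProbabilityMeasure μ]
    (X : ℝ → Ω → ℝ) (lam b T : ℝ) (hlam : 0 < lam) (hb0 : 0 < b) (hb1 : b ≤ 1) (hT : 0 < T)
    (hX : IsExpProcess μ X lam b T) :
    -- all the moments below are finite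
    (∀ d t : ℝ, 0 < d → d ≤ t → t ≤ T → ∀ n : ℕ, MemLp (increment X d t) n μ) ∧
    -- (i)
    (∀ t s : ℝ, 0 < t → t < s → s ≤ T →
      (∀ d : ℝ, 0 < d → d ≤ t → d < s - t →
        ∫ ω, increment X d t ω * increment X d s ω ∂μ
          = b * Real.exp (-lam * T) / lam ^ 2 * Real.exp (-lam * (s - t))
              * (Real.exp (lam * d) - 2 + Real.exp (-lam * d))) ∧
      (fun d : ℝ => ∫ ω, increment X d t ω * increment X d s ω ∂μ) ~[𝓝[>] 0]
        (fun d : ℝ => d ^ 2 * (b * Real.exp (-lam * T)) * Real.exp (-lam * (s - t))) ∧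
      (fun d : ℝ => cov[increment X d t, increment X d s; μ]) ~[𝓝[>] 0]
        (fun d : ℝ => d ^ 2 * (b * Real.exp (-lam * T))
            * (Real.exp (-lam * (s - t)) - b * Real.exp (-lam * T))) ∧
      (fun d : ℝ => corr (increment X d t) (increment X d s) μ) ~[𝓝[>] 0]
        (fun _ : ℝ => (Real.exp (-lam * (s - t)) - b * Real.exp (-lam * T))
            / (1 - b * Real.exp (-lam * T)))) ∧
    -- (ii), for fixed `d`, and for `p = (t, s)` with `d ≤ t < s ≤ T` and `s - t → 0`
    (∀ d : ℝ, 0 < d →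
      (fun p : ℝ × ℝ => corr (increment X d p.1) (increment X d p.2) μ)
          ~[comap (fun p : ℝ × ℝ => p.2 - p.1) (𝓝[>] 0) ⊓ 𝓟 {p | d ≤ p.1 ∧ p.2 ≤ T}]
        (fun p : ℝ × ℝ =>
          1 - 2 * b * Real.exp (-lam * T) / (lam ^ 2 * Var[increment X d p.1; μ])
            * (p.2 - p.1)) ∧
      (fun p : ℝ × ℝ => 1 - corr (increment X d p.1) (increment X d p.2) μ)
          ~[comap (fun p : ℝ × ℝ => p.2 - p.1) (𝓝[>] 0) ⊓ 𝓟 {p | d ≤ p.1 ∧ p.2 ≤ T}]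
        (fun p : ℝ × ℝ =>
          b * Real.exp (-lam * T) * (1 - Real.exp (-lam * d)) / Var[increment X d p.1; μ]
            * (p.2 - p.1) ^ 2)) ∧
    -- (iii), for the `m + 1` times `t 0 < t 1 < ⋯ < t m`
    (∀ (m : ℕ) (t : Fin (m + 1) → ℝ) (k : Fin (m + 1) → ℕ), 0 < t 0 → StrictMono t →
      t (Fin.last m) ≤ T → (∀ i, 1 ≤ k i) →
      (fun d : ℝ => ∫ ω, ∏ i, increment X d (t i) ω ^ k i ∂μ) ~[𝓝[>] 0]
        (fun d : ℝ => d ^ (∑ i, k i) * (b * Real.exp (-lam * T))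
            * Real.exp (-lam * (t (Fin.last m) - t 0))) ∧
      Tendsto
        (fun d : ℝ => (∫ ω, ∏ i, increment X d (t i) ω ^ k i ∂μ)
            / ∏ i, ∫ ω, increment X d (t i) ω ^ k i ∂μ)
        (𝓝[>] 0)
        (𝓝 ((1 / (b * Real.exp (-lam * T))) ^ m
            * Real.exp (-lam * (t (Fin.last m) - t 0))))) := by
  have hc0 : 0 < b * Real.exp (-lam * T) := by positivity
  -- With `r = s - t` and `r = 0` this makes the limits of covariance and correlation nonzero, as
  -- passing from a limit to an equivalence requires.
  have hclt : ∀ r < T, b * Real.exp (-lam * T) < Real.exp (-lam * r) := fun r hr => by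
    have h1 : Real.exp (-lam * T) < Real.exp (-lam * r) := Real.exp_lt_exp.mpr (by nlinarith)
    nlinarith [Real.exp_pos (-lam * T)]
  have hc1 : b * Real.exp (-lam * T) < 1 := by simpa using hclt 0 hT
  refine ⟨fun d t hd hdt ht n => hX.memLp_increment hd.le hdt ht n, fun t s ht hts hs => ?_,
    fun d hd => hX.corr_increment_isEquivalent_of_overlap hlam hb0 hb1 hd,
    fun m t k h0 ht hT k1 => ⟨?_,
      hX.tendsto_integral_prod_increment_pow_ratio hlam.le hb0 h0 ht hT k1⟩⟩
  · have hgap : 0 < Real.exp (-lam * (s - t)) - b * Real.exp (-lam * T) :=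
      sub_pos.mpr (hclt _ (by linarith))
    refine ⟨fun d hd hdt hds =>
      hX.integral_increment_mul_of_disjoint hlam.ne' hd.le hdt hds.le hs, ?_, ?_, ?_⟩
    · simp_rw [mul_assoc (_ ^ 2)]
      exact isEquivalent_pow_mul_of_tendsto_div (by positivity)
        (hX.tendsto_integral_increment_mul_div hlam.le hb0.le ht hts hs)
    · simp_rw [mul_assoc (_ ^ 2)]
      exact isEquivalent_pow_mul_of_tendsto_div (by positivity)
        (hX.tendsto_covariance_increment_div hlam.le hb0.le ht hts hs)
    · exact (isEquivalent_const_iff_tendsto (div_pos hgap (sub_pos.mpr hc1)).ne').mpr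
        (hX.tendsto_corr_increment hlam.le hb0 hc1 ht hts hs)
  · simp_rw [mul_assoc (_ ^ (∑ i, k i))]
    exact isEquivalent_pow_mul_of_tendsto_div (by positivity)
      (hX.tendsto_integral_prod_increment_pow_div hlam.le hb0.le h0 ht hT k1)
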